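/- Theorem. Let $\mathbb K=\mathbb R$ or $\mathbb C$, let $r,n\ge 0$ be integers, and work throughout in one of the following classes of germs: smooth or real-analytic if $\mathbb K=\mathbb R$, holomorphic if $\mathbb K=\mathbb C$. Let $A:(\mathbb K^r,0)\to \mathrm{Sym}_n(\mathbb K)$ be a germ at $0$ of a map (of the chosen class) with values in the symmetric $n\times n$ matrices. Suppose that $A$ is symmetrically quasi-homogeneous, that is, there are coordinates $(x_1,\dots,x_r)$ on $(\mathbb K^r,0)$ centred at $0$, integers $\lambda_1,\dots,\lambda_r\ge 0$ with $\sum_k\lambda_k>0$, integers $\delta_1,\dots,\delta_n\ge 0$ and a map-germ $X:(\mathbb K^r,0)\to \mathrm{GL}_n(\mathbb K)$ such that $B=X^TAX$, written in these coordinates, satisfies $$B_{ij}(t^{\lambda_1}x_1,\dots,t^{\lambda_r}x_r)=t^{\frac12(\delta_i+\delta_j)}B_{ij}(x_1,\dots,x_r)\qquad(1\le i,j\le n)$$ as germs at $x=0$, for every real $t>0$. Let $\mathcal D_A$ be the group of all diffeomorphism-germs $\Phi:(\mathbb K^r,0)\to(\mathbb K^r,0)$ for which there is a map-germ $Y:(\mathbb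 K^r,0)\to \mathrm{GL}_n(\mathbb K)$ with $A=Y^T(A\circ\Phi)Y$. Then any two germs at $0$ of volume forms $\Omega_0,\Omega_1$ on $\mathbb K^r$ (i.e. germs of $r$-forms, holomorphic if $\mathbb K=\mathbb C$, not vanishing at $0$), which for $\mathbb K=\mathbb R$ are assumed to define the same orientation, are $\mathcal D_A$-isotopic: there is a family of diffeomorphism-germs $\Phi_t\in\mathcal D_A$, $t\in[0,1]$, such that $\Phi_0=\mathrm{Id}$ and $\Phi_1^*\Omega_1=\Omega_0$, and such that $(t,x)\mapsto\Phi_t(x)$ is the restriction of a map of the chosen class defined on a neighbourhood of $[0,1]\times\{0\}$ in $\mathbb K\times\mathbb K^r$. -/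

import Mathlib

open Filter Topology
open scoped ContDiff Matrix

noncomputable section

namespace SymGerm

/-! Germs at `0` of maps on `𝕜^r` (with `𝕜 = ℝ` or `ℂ`) are represented by globally defined
functions, and every condition on them is imposed only near `0`. The regularity class is
`m = ∞` (smooth) or `m = ω` (`𝕜`-analytic). -/

variable {𝕜 : Type} [RCLike 𝕜] {r n : ℕ}

/-- `f` is of class `m` on some neighbourhood of the point `a`.
(`ContDiffAt 𝕜 ∞ f a` alone would let the neighbourhood depend on the order of differentiation.) -/
def RegularNear (𝕜 : Type) [RCLike 𝕜] {E F : Type} [NormedAddCommGroup E] [NormedSpace 𝕜 E]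
    [NormedAddCommGroup F] [NormedSpace 𝕜 F] (m : WithTop ℕ∞) (f : E → F) (a : E) : Prop :=
  ∀ᶠ x in 𝓝 a, ContDiffAt 𝕜 m f x

/-- Germs of class `m` of `n × n` matrix-valued maps at `0 ∈ 𝕜^r` (regularity is entrywise). -/
def IsMatrixGerm (m : WithTop ℕ∞) (A : (Fin r → 𝕜) → Matrix (Fin n) (Fin n) 𝕜) : Prop :=
  ∀ i j, RegularNear 𝕜 m (fun x => A x i j) 0

/-- Map-germs `(𝕜^r, 0) → Sym_n`. -/
def IsSymGerm (m : WithTop ℕ∞) (A : (Fin r → 𝕜) → Matrix (Fin n) (Fin n) 𝕜) : Prop :=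
  IsMatrixGerm m A ∧ ∀ᶠ x in 𝓝 0, (A x).IsSymm

/-- Map-germs `(𝕜^r, 0) → GL_n`. -/
def IsGLGerm (m : WithTop ℕ∞) (X : (Fin r → 𝕜) → Matrix (Fin n) (Fin n) 𝕜) : Prop :=
  IsMatrixGerm m X ∧ ∀ᶠ x in 𝓝 0, IsUnit (X x)

/-- Diffeomorphism-germs `(𝕜^r, 0) → (𝕜^r, 0)` of class `m`: germs fixing `0` with a
two-sided inverse germ of class `m`. -/
def IsDiffeoGerm (m : WithTop ℕ∞) (Φ : (Fin r → 𝕜) → (Fin r → 𝕜)) : Prop :=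
  Φ 0 = 0 ∧ RegularNear 𝕜 m Φ 0 ∧
    ∃ Ψ : (Fin r → 𝕜) → (Fin r → 𝕜), Ψ 0 = 0 ∧ RegularNear 𝕜 m Ψ 0 ∧
      (∀ᶠ x in 𝓝 0, Ψ (Φ x) = x) ∧ ∀ᶠ x in 𝓝 0, Φ (Ψ x) = x

/-- The germ `Xᵀ A X`. -/
def congruence (X A : (Fin r → 𝕜) → Matrix (Fin n) (Fin n) 𝕜) :
    (Fin r → 𝕜) → Matrix (Fin n) (Fin n) 𝕜 :=
  fun x => (X x)ᵀ * A x * X x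

/-- The isotropy group `𝒟_A` of `A`: the diffeomorphism-germs `Φ` with
`A = Xᵀ (A ∘ Φ) X` for some map-germ `X` into `GL_n`. -/
def isotropyGroup (m : WithTop ℕ∞) (A : (Fin r → 𝕜) → Matrix (Fin n) (Fin n) 𝕜) :
    Set ((Fin r → 𝕜) → (Fin r → 𝕜)) :=
  {Φ | IsDiffeoGerm m Φ ∧ ∃ X : (Fin r → 𝕜) → Matrix (Fin n) (Fin n) 𝕜, IsGLGerm m X ∧
    ∀ᶠ x in 𝓝 0, A x = congruence X (A ∘ Φ) x}

/-- `A` is symmetrically quasi-homogeneous: there are `X` with values in `GL_n`, coordinates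
`(x_1, …, x_r)` centred at `0` (`ψ` maps the coordinates of a point to the point), weights
`w_k ≥ 0` with positive sum and quasi-degrees `δ_i ≥ 0`, such that `B = Xᵀ A X`, written in
these coordinates, satisfies
`B_ij (t ^ w_1 x_1, …, t ^ w_r x_r) = t ^ ((δ_i + δ_j) / 2) B_ij (x_1, …, x_r)`
as an equality of germs at `0`, for every `t > 0` (where the possibly half-integral power
is unambiguous). -/
def IsSymmetricallyQuasiHomogeneous (m : WithTop ℕ∞)
    (A : (Fin r → 𝕜) → Matrix (Fin n) (Fin n) 𝕜) : Prop :=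
  ∃ (ψ : (Fin r → 𝕜) → (Fin r → 𝕜)) (X : (Fin r → 𝕜) → Matrix (Fin n) (Fin n) 𝕜)
    (w : Fin r → ℕ) (δ : Fin n → ℕ),
    IsDiffeoGerm m ψ ∧ IsGLGerm m X ∧ 0 < ∑ k, w k ∧
    ∀ t : ℝ, 0 < t → ∀ i j, ∀ᶠ x in 𝓝 (0 : Fin r → 𝕜),
      congruence X A (ψ fun k => (t : 𝕜) ^ w k * x k) i j =
        ((t ^ (((δ i : ℝ) + (δ j : ℝ)) / 2) : ℝ) : 𝕜) * congruence X A (ψ x) i j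

/-- Volume form-germs at `0` on `𝕜^r`: germs of differential `r`-forms of class `m` that do
not vanish at `0`. -/
def IsVolumeFormGerm (m : WithTop ℕ∞) (Ω : (Fin r → 𝕜) → (Fin r → 𝕜) [⋀^Fin r]→L[𝕜] 𝕜) : Prop :=
  RegularNear 𝕜 m Ω 0 ∧ Ω 0 ≠ 0

/-- The pullback `Φ^* Ω` of a differential `r`-form. -/
def pullback (Φ : (Fin r → 𝕜) → (Fin r → 𝕜)) (Ω : (Fin r → 𝕜) → (Fin r → 𝕜) [⋀^Fin r]→L[𝕜] 𝕜) :
    (Fin r → 𝕜) → (Fin r → 𝕜) [⋀^Fin r]→L[𝕜] 𝕜 :=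
  fun x => (Ω (Φ x)).compContinuousLinearMap (fderiv 𝕜 Φ x)

/-- `Ω₀` and `Ω₁` are `H`-isotopic: there is a family `Φ_t ∈ H`, `t ∈ [0, 1]`, of class `m` in
`(t, x)` jointly, with `Φ_0 = Id` and `Φ_1^* Ω₁ = Ω₀`. The family is required to be the
restriction of a map of class `m` over `𝕜` on a neighbourhood of `[0, 1] × {0}` in `𝕜 × 𝕜^r`. -/
def Isotopic (m : WithTop ℕ∞) (H : Set ((Fin r → 𝕜) → (Fin r → 𝕜)))
    (Ω₀ Ω₁ : (Fin r → 𝕜) → (Fin r → 𝕜) [⋀^Fin r]→L[𝕜] 𝕜) : Prop :=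
  ∃ Φ : 𝕜 → (Fin r → 𝕜) → (Fin r → 𝕜),
    (∀ t : ℝ, t ∈ Set.Icc (0 : ℝ) 1 →
      RegularNear 𝕜 m (fun p : 𝕜 × (Fin r → 𝕜) => Φ p.1 p.2) ((t : 𝕜), 0) ∧ Φ (t : 𝕜) ∈ H) ∧
    (∀ᶠ x in 𝓝 0, Φ 0 x = x) ∧
    ∀ᶠ x in 𝓝 0, pullback (Φ 1) Ω₁ x = Ω₀ x

/-- Two real volume form-germs define the same orientation: their values at `0` lie on the same
ray (an orientation is a ray of top-degree alternating forms). -/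
def SameOrientation (Ω₀ Ω₁ : (Fin r → ℝ) → (Fin r → ℝ) [⋀^Fin r]→L[ℝ] ℝ) : Prop :=
  SameRay ℝ (Ω₀ 0) (Ω₁ 0)

end SymGerm

end

/-! No flow is integrated: the isotopy is written down explicitly. In the coordinates of the normal
form `B`, let `E = ∑ w_k x_k ∂_k` and `W = ∑ w_k`. Every map `φ(x) = exp(g(x) E) x`, with `g` an
arbitrary function germ, preserves `B` up to congruence: `B` is equivariant under each single
dilation, and the exponent may vary from point to point because equivariance is a pointwise
identity, uniform for bounded exponents (`quasiHomogeneous_dilate`). Replacing `g` by `t g` stays in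
the group and joins `φ` to the identity, so only one `g` with `φ^* Ω₁ = Ω₀` is needed.

Write the two densities as `ρ_i = W R_i + E R_i` (`exists_radial_primitive`), that is, `ρ_i dx =
d(R_i ι_E dx)`. The form `ι_E dx` is killed by `ι_E`, so `φ` pulls it back to `exp(g W) ι_E dx`
without any `dg` term. The differential equation for `φ` therefore follows from the scalar equation
`exp(g W) R₁(φ(x)) = R₀(x)`, which the implicit function theorem solves for `g(x)`
(`exists_dilation_pullback`).

Equivariance is assumed only germwise for each real `t > 0`, on a neighbourhood depending on `t`. A
Baire category argument extracts the Euler relation (`euler_of_quasiHomogeneous`), whose integration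
gives uniform equivariance for exponents in `𝕜` (`scaling_of_euler`). -/

namespace SymGerm

/-! ### Calculus of germs: closure properties, inverse and implicit functions. -/

section Regular

variable {𝕜 : Type} [RCLike 𝕜] {E F G : Type} [NormedAddCommGroup E] [NormedSpace 𝕜 E]
  [NormedAddCommGroup F] [NormedSpace 𝕜 F] [NormedAddCommGroup G] [NormedSpace 𝕜 G]
  {m : WithTop ℕ∞}

theorem RegularNear.contDiffAt {f : E → F} {a : E} (hf : RegularNear 𝕜 m f a) :
    ContDiffAt 𝕜 m f a :=
  hf.self_of_nhds

theorem RegularNear.continuousAt {f : E → F} {a : E} (hf : RegularNear 𝕜 m f a) :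
    ContinuousAt f a :=
  hf.contDiffAt.continuousAt

theorem RegularNear.eventually_differentiableAt {f : E → F} {a : E} (hf : RegularNear 𝕜 m f a)
    (hm : m ≠ 0) : ∀ᶠ x in 𝓝 a, DifferentiableAt 𝕜 f x :=
  hf.mono fun _ hx => hx.differentiableAt hm

theorem regularNear_of_contDiff {f : E → F} (hf : ContDiff 𝕜 m f) (a : E) : RegularNear 𝕜 m f a :=
  Eventually.of_forall fun _ => hf.contDiffAt

theorem RegularNear.comp {g : F → G} {f : E → F} {a : E} (hg : RegularNear 𝕜 m g (f a))
    (hf : RegularNear 𝕜 m f a) : RegularNear 𝕜 m (fun x => g (f x)) a := by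
  filter_upwards [hf, hf.continuousAt.eventually hg] with x hx hy using hy.comp x hx

theorem RegularNear.comp_of_eq {g : F → G} {f : E → F} {a : E} {b : F}
    (hg : RegularNear 𝕜 m g b) (hf : RegularNear 𝕜 m f a) (hab : f a = b) :
    RegularNear 𝕜 m (fun x => g (f x)) a := by
  subst hab
  exact hg.comp hf

theorem RegularNear.mul {f g : E → 𝕜} {a : E} (hf : RegularNear 𝕜 m f a)
    (hg : RegularNear 𝕜 m g a) : RegularNear 𝕜 m (fun x => f x * g x) a := by
  filter_upwards [hf, hg] with x hx hy using hx.mul hy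

theorem RegularNear.const_mul {f : E → 𝕜} {a : E} (c : 𝕜) (hf : RegularNear 𝕜 m f a) :
    RegularNear 𝕜 m (fun x => c * f x) a := by
  filter_upwards [hf] with x hx using contDiffAt_const.mul hx

theorem RegularNear.sum {ι : Type} {s : Finset ι} {f : ι → E → 𝕜} {a : E}
    (hf : ∀ i ∈ s, RegularNear 𝕜 m (f i) a) :
    RegularNear 𝕜 m (fun x => ∑ i ∈ s, f i x) a := by
  have := (Filter.eventually_all_finset s).2 hf
  filter_upwards [this] with x hx using ContDiffAt.sum hx

theorem RegularNear.prod {ι : Type} {s : Finset ι} {f : ι → E → 𝕜} {a : E}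
    (hf : ∀ i ∈ s, RegularNear 𝕜 m (f i) a) :
    RegularNear 𝕜 m (fun x => ∏ i ∈ s, f i x) a := by
  have := (Filter.eventually_all_finset s).2 hf
  filter_upwards [this] with x hx using contDiffAt_prod hx

theorem RegularNear.pi {ι : Type} [Fintype ι] {f : E → ι → 𝕜} {a : E}
    (hf : ∀ i, RegularNear 𝕜 m (fun x => f x i) a) : RegularNear 𝕜 m f a := by
  filter_upwards [Filter.eventually_all.2 hf] with x hx using contDiffAt_pi.2 hx

theorem RegularNear.apply {ι : Type} [Fintype ι] {f : E → ι → 𝕜} {a : E}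
    (hf : RegularNear 𝕜 m f a) (i : ι) : RegularNear 𝕜 m (fun x => f x i) a := by
  filter_upwards [hf] with x hx using contDiffAt_pi.1 hx i

theorem RegularNear.inv {f : E → 𝕜} {a : E} (hf : RegularNear 𝕜 m f a) (h0 : f a ≠ 0) :
    RegularNear 𝕜 m (fun x => (f x)⁻¹) a := by
  filter_upwards [hf, hf.continuousAt.eventually_ne h0] with x hx hy using hx.inv hy

theorem RegularNear.exp {f : E → 𝕜} {a : E} (hf : RegularNear 𝕜 m f a) :
    RegularNear 𝕜 m (fun x => NormedSpace.exp (f x)) a := by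
  have : ContDiff 𝕜 m (NormedSpace.exp : 𝕜 → 𝕜) :=
    contDiff_iff_contDiffAt.2 fun x => (NormedSpace.exp_analytic (𝕂 := 𝕜) x).contDiffAt
  exact (regularNear_of_contDiff this (f a)).comp hf

theorem RegularNear.fderiv_right {f : E → F} {a : E} (hf : RegularNear 𝕜 m f a) (hm : m + 1 ≤ m) :
    RegularNear 𝕜 m (fun x => fderiv 𝕜 f x) a := by
  filter_upwards [hf] with x hx using hx.fderiv_right hm

theorem RegularNear.clm_apply {f : E → F →L[𝕜] G} {a : E} (hf : RegularNear 𝕜 m f a) (v : F) :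
    RegularNear 𝕜 m (fun x => f x v) a := by
  filter_upwards [hf] with x hx using hx.clm_apply contDiffAt_const

theorem RegularNear.det {k : ℕ} {M : E → Matrix (Fin k) (Fin k) 𝕜} {a : E}
    (hM : ∀ i j, RegularNear 𝕜 m (fun x => M x i j) a) :
    RegularNear 𝕜 m (fun x => (M x).det) a := by
  simp only [Matrix.det_apply']
  exact RegularNear.sum fun σ _ => (RegularNear.prod fun i _ => hM _ _).const_mul _

theorem RegularNear.matrix_mul {k : ℕ} {M N : E → Matrix (Fin k) (Fin k) 𝕜} {a : E}
    (hM : ∀ i j, RegularNear 𝕜 m (fun x => M x i j) a)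
    (hN : ∀ i j, RegularNear 𝕜 m (fun x => N x i j) a) (i j : Fin k) :
    RegularNear 𝕜 m (fun x => (M x * N x) i j) a := by
  simp only [Matrix.mul_apply]
  exact RegularNear.sum fun l _ => (hM i l).mul (hN l j)

theorem RegularNear.matrix_inv {k : ℕ} {M : E → Matrix (Fin k) (Fin k) 𝕜} {a : E}
    (hM : ∀ i j, RegularNear 𝕜 m (fun x => M x i j) a) (h0 : IsUnit (M a)) (i j : Fin k) :
    RegularNear 𝕜 m (fun x => (M x)⁻¹ i j) a := by
  have hdet : (M a).det ≠ 0 := ((Matrix.isUnit_iff_isUnit_det _).1 h0).ne_zero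
  simp only [Matrix.inv_def, Matrix.smul_apply, smul_eq_mul, Ring.inverse_eq_inv',
    Matrix.adjugate_apply]
  refine ((RegularNear.det hM).inv hdet).mul (RegularNear.det fun p q => ?_)
  by_cases hp : p = j
  · subst hp
    simp only [Matrix.updateRow_self]
    exact regularNear_of_contDiff contDiff_const a
  · simp only [Matrix.updateRow_ne hp]
    exact hM p q

/-- Inverse function theorem for germs. -/
theorem RegularNear.exists_local_inverse [FiniteDimensional 𝕜 E] {f : E → E} {a : E}
    (hf : RegularNear 𝕜 m f a) (hm : m ≠ 0)
    (hinj : ∀ v, fderiv 𝕜 f a v = 0 → v = 0) :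
    ∃ h : E → E, h (f a) = a ∧ RegularNear 𝕜 m h (f a) ∧
      (∀ᶠ x in 𝓝 a, h (f x) = x) ∧ ∀ᶠ y in 𝓝 (f a), f (h y) = y := by
  have : CompleteSpace E := FiniteDimensional.complete 𝕜 E
  let e : E ≃L[𝕜] E := (LinearEquiv.ofInjectiveEndo (fderiv 𝕜 f a : E →ₗ[𝕜] E)
    (by
      rw [← LinearMap.ker_eq_bot, LinearMap.ker_eq_bot']
      exact hinj)).toContinuousLinearEquiv
  have he : (e : E →L[𝕜] E) = fderiv 𝕜 f a := by
    ext v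
    simp [e]
  have hd : HasFDerivAt f (e : E →L[𝕜] E) a := by
    rw [he]
    exact (hf.contDiffAt.differentiableAt hm).hasFDerivAt
  let H := hf.contDiffAt.toOpenPartialHomeomorph f hd hm
  have hHf : ∀ x, H x = f x := fun x => rfl
  have hsrc : a ∈ H.source := hf.contDiffAt.mem_toOpenPartialHomeomorph_source hd hm
  have htgt : f a ∈ H.target := H.map_source hsrc
  have hsymm : H.symm (f a) = a := H.left_inv hsrc
  have hcont : ContinuousAt H.symm (f a) := H.continuousAt_symm htgt
  -- Regularity of the inverse is required at all points near `f a`, so the derivative must be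
  -- invertible near `a` and not only at `a`.
  have hinv : ∀ᶠ x in 𝓝 a, ∃ e' : E ≃L[𝕜] E, (e' : E →L[𝕜] E) = fderiv 𝕜 f x := by
    have hc : ContinuousAt (fderiv 𝕜 f) a :=
      (hf.contDiffAt.fderiv_right (m := 0) (by simpa using ENat.one_le_iff_ne_zero_withTop.2 hm)).continuousAt
    have := hc.eventually (he ▸ ContinuousLinearEquiv.nhds e)
    exact this
  have htend : Tendsto H.symm (𝓝 (f a)) (𝓝 a) := by
    simpa [ContinuousAt, hsymm] using hcont
  refine ⟨H.symm, hsymm, ?_, ?_, ?_⟩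
  · filter_upwards [H.open_target.mem_nhds htgt, htend.eventually hf, htend.eventually hinv]
      with y hy hfy hey
    obtain ⟨e', he'⟩ := hey
    refine H.contDiffAt_symm (f₀' := e') hy ?_ hfy
    rw [he']
    exact (hfy.differentiableAt hm).hasFDerivAt
  · filter_upwards [H.open_source.mem_nhds hsrc] with x hx using H.left_inv hx
  · filter_upwards [H.open_target.mem_nhds htgt] with y hy using H.right_inv hy

/-- Implicit function theorem for scalar equations between germs. -/
theorem RegularNear.exists_implicit [FiniteDimensional 𝕜 E] {f : E × 𝕜 → 𝕜} {a : E} {s : 𝕜}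
    (hf : RegularNear 𝕜 m f (a, s)) (hm : m ≠ 0) (h0 : f (a, s) = 0)
    (hs : fderiv 𝕜 f (a, s) (0, 1) ≠ 0) :
    ∃ g : E → 𝕜, g a = s ∧ RegularNear 𝕜 m g a ∧ ∀ᶠ x in 𝓝 a, f (x, g x) = 0 := by
  -- The map `(x, s) ↦ (x, f (x, s))` is locally invertible; the solution `g x` is the second
  -- component of its inverse at `(x, 0)`.
  have hG : RegularNear 𝕜 m (fun p : E × 𝕜 => (p.1, f p)) (a, s) := by
    filter_upwards [hf] with p hp using contDiffAt_fst.prodMk hp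
  have hd : DifferentiableAt 𝕜 f (a, s) := hf.contDiffAt.differentiableAt hm
  have hdG : fderiv 𝕜 (fun p : E × 𝕜 => (p.1, f p)) (a, s) =
      (ContinuousLinearMap.fst 𝕜 E 𝕜).prod (fderiv 𝕜 f (a, s)) :=
    (hasFDerivAt_fst.prodMk hd.hasFDerivAt).fderiv
  obtain ⟨h, hh0, hh, -, hr⟩ := hG.exists_local_inverse hm (by
    rintro ⟨v, σ⟩ hv
    rw [hdG] at hv
    simp only [ContinuousLinearMap.prod_apply, ContinuousLinearMap.coe_fst',
      Prod.mk_eq_zero] at hv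
    obtain ⟨rfl, hv⟩ := hv
    have : ((0 : E), σ) = σ • ((0 : E), (1 : 𝕜)) := by simp
    rw [this, map_smul, smul_eq_mul, mul_eq_zero] at hv
    simp [hv.resolve_right hs])
  simp only [h0] at hh0 hh hr
  have hinc : ContDiff 𝕜 m (fun x : E => (x, (0 : 𝕜))) := contDiff_id.prodMk contDiff_const
  have hinc' : Tendsto (fun x : E => (x, (0 : 𝕜))) (𝓝 a) (𝓝 (a, 0)) :=
    hinc.continuous.tendsto a
  refine ⟨fun x => (h (x, 0)).2, by simp [hh0], ?_, ?_⟩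
  · have := RegularNear.comp (g := h) (f := fun x : E => (x, (0 : 𝕜))) hh (regularNear_of_contDiff hinc a)
    filter_upwards [this] with x hx using hx.snd
  · filter_upwards [hinc'.eventually hr] with x hx
    rw [Prod.ext_iff] at hx
    simp only at hx
    have : h (x, 0) = (x, (h (x, 0)).2) := Prod.ext hx.1 rfl
    rw [← this]
    exact hx.2

end Regular

end SymGerm

namespace SymGerm

/-! ### Regularity of integrals over a family of linear contractions. -/

section Integral

variable {𝕜 : Type} [RCLike 𝕜] {E : Type} [NormedAddCommGroup E] [NormedSpace 𝕜 E]

section Smooth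

variable {F G : Type} [NormedAddCommGroup F] [NormedSpace 𝕜 F] [NormedAddCommGroup G]
  [NormedSpace 𝕜 G] {D : ℝ → E →L[𝕜] E} {ε : ℝ}

theorem mem_ball_of_contraction (hD1 : ∀ τ ∈ Set.Icc (0 : ℝ) 1, ∀ x, ‖D τ x‖ ≤ ‖x‖) {τ : ℝ}
    (hτ : τ ∈ Set.Icc (0 : ℝ) 1) {x : E} (hx : x ∈ Metric.ball (0 : E) ε) :
    D τ x ∈ Metric.ball (0 : E) ε := by
  rw [mem_ball_zero_iff] at hx ⊢
  exact (hD1 τ hτ x).trans_lt hx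

theorem continuousOn_comp_contraction (hDc : Continuous D)
    (hD1 : ∀ τ ∈ Set.Icc (0 : ℝ) 1, ∀ x, ‖D τ x‖ ≤ ‖x‖)
    {f : E → F} (hf : ContinuousOn f (Metric.ball 0 ε)) {L : ℝ → F →L[𝕜] G} (hL : Continuous L)
    {x : E} (hx : x ∈ Metric.ball (0 : E) ε) :
    ContinuousOn (fun τ => L τ (f (D τ x))) (Set.Icc 0 1) := by
  have h1 : ContinuousOn (fun τ => f (D τ x)) (Set.Icc 0 1) :=
    hf.comp (hDc.clm_apply continuous_const).continuousOn
      fun τ hτ => mem_ball_of_contraction hD1 hτ hx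
  exact hL.continuousOn.clm_apply h1

/-- Differentiation under the integral sign for `x ↦ ∫ L τ (f (D τ x)) dτ`. -/
theorem hasFDerivAt_integral_contraction [ProperSpace E] [NormedSpace ℝ G] (hDc : Continuous D)
    (hD1 : ∀ τ ∈ Set.Icc (0 : ℝ) 1, ∀ x, ‖D τ x‖ ≤ ‖x‖)
    {f : E → F} (hf : ContDiffOn 𝕜 1 f (Metric.ball 0 ε)) {L : ℝ → F →L[𝕜] G}
    (hL : Continuous L) {x : E} (hx : x ∈ Metric.ball (0 : E) ε) :
    HasFDerivAt (fun x => ∫ τ in (0 : ℝ)..1, L τ (f (D τ x)))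
      (∫ τ in (0 : ℝ)..1, (L τ).comp ((fderiv 𝕜 f (D τ x)).comp (D τ))) x := by
  have hfd : ContinuousOn (fderiv 𝕜 f) (Metric.ball 0 ε) :=
    hf.continuousOn_fderiv_of_isOpen Metric.isOpen_ball le_rfl
  have hcont : ∀ y ∈ Metric.ball (0 : E) ε,
      ContinuousOn (fun τ => (L τ).comp ((fderiv 𝕜 f (D τ y)).comp (D τ))) (Set.Icc 0 1) := by
    intro y hy
    have h1 : ContinuousOn (fun τ => fderiv 𝕜 f (D τ y)) (Set.Icc 0 1) :=
      hfd.comp (hDc.clm_apply continuous_const).continuousOn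
        fun τ hτ => mem_ball_of_contraction hD1 hτ hy
    exact hL.continuousOn.clm_comp (h1.clm_comp hDc.continuousOn)
  have hxε := mem_ball_zero_iff.1 hx
  -- On a smaller closed ball, compactness of its product with `[0, 1]` bounds the derivative of the
  -- integrand by a constant, which serves as dominating function.
  obtain ⟨ρ, hxρ, hρε⟩ := exists_between hxε
  have hsub : Metric.closedBall (0 : E) ρ ⊆ Metric.ball 0 ε := Metric.closedBall_subset_ball hρε
  have hK : IsCompact (Set.Icc (0 : ℝ) 1 ×ˢ Metric.closedBall (0 : E) ρ) :=
    isCompact_Icc.prod (isCompact_closedBall 0 ρ)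
  have hjoint : ContinuousOn
      (fun p : ℝ × E => (L p.1).comp ((fderiv 𝕜 f (D p.1 p.2)).comp (D p.1)))
      (Set.Icc (0 : ℝ) 1 ×ˢ Metric.closedBall (0 : E) ρ) := by
    have h1 : ContinuousOn (fun p : ℝ × E => fderiv 𝕜 f (D p.1 p.2))
        (Set.Icc (0 : ℝ) 1 ×ˢ Metric.closedBall (0 : E) ρ) :=
      hfd.comp ((hDc.comp continuous_fst).clm_apply continuous_snd).continuousOn
        fun p hp => mem_ball_of_contraction hD1 hp.1 (hsub hp.2)
    exact (hL.comp continuous_fst).continuousOn.clm_comp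
      (h1.clm_comp (hDc.comp continuous_fst).continuousOn)
  obtain ⟨C, hC⟩ := hK.exists_bound_of_continuousOn hjoint
  have hI : Set.uIoc (0 : ℝ) 1 ⊆ Set.Icc 0 1 := by
    rw [Set.uIoc_of_le zero_le_one]
    exact Set.Ioc_subset_Icc_self
  have hs : Metric.ball (0 : E) ρ ∈ 𝓝 x :=
    Metric.isOpen_ball.mem_nhds (mem_ball_zero_iff.2 hxρ)
  refine intervalIntegral.hasFDerivAt_integral_of_dominated_of_fderiv_le
    (F := fun y τ => L τ (f (D τ y)))
    (F' := fun y τ => (L τ).comp ((fderiv 𝕜 f (D τ y)).comp (D τ)))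
    (bound := fun _ => C) hs ?_ ?_ ?_ ?_ intervalIntegrable_const ?_
  · filter_upwards [hs] with y hy
    exact ((continuousOn_comp_contraction hDc hD1 hf.continuousOn hL
      (hsub (Metric.ball_subset_closedBall hy))).mono hI).aestronglyMeasurable measurableSet_uIoc
  · refine ContinuousOn.intervalIntegrable ?_
    rw [Set.uIcc_of_le zero_le_one]
    exact continuousOn_comp_contraction hDc hD1 hf.continuousOn hL hx
  · exact ((hcont x hx).mono hI).aestronglyMeasurable measurableSet_uIoc
  · exact Eventually.of_forall fun τ hτ y hy =>
      hC (τ, y) ⟨hI hτ, Metric.ball_subset_closedBall hy⟩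
  · refine Eventually.of_forall fun τ hτ y hy => ?_
    have hm := mem_ball_of_contraction hD1 (hI hτ) (hsub (Metric.ball_subset_closedBall hy))
    have h1 : HasFDerivAt f (fderiv 𝕜 f (D τ y)) (D τ y) :=
      ((hf.contDiffAt (Metric.isOpen_ball.mem_nhds hm)).differentiableAt one_ne_zero).hasFDerivAt
    exact (L τ).hasFDerivAt.comp y (h1.comp y (D τ).hasFDerivAt)

end Smooth

/-- The derivative of the integral is an integral of the same shape, with `fderiv 𝕜 f` for `f` and
`T ↦ L τ ∘ T ∘ D τ` for `L τ`. This explains the operator weight `L` and the quantification over `F`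
and `G` after `k`: the induction changes the target spaces. The extra derivative demanded of `f`
costs nothing in the smooth class. -/
theorem contDiffOn_integral_contraction [ProperSpace E] {D : ℝ → E →L[𝕜] E} {ε : ℝ}
    (hDc : Continuous D) (hD1 : ∀ τ ∈ Set.Icc (0 : ℝ) 1, ∀ x, ‖D τ x‖ ≤ ‖x‖) (k : ℕ) :
    ∀ {F G : Type} [NormedAddCommGroup F] [NormedSpace 𝕜 F] [NormedAddCommGroup G]
      [NormedSpace 𝕜 G] [NormedSpace ℝ G] [SMulCommClass 𝕜 ℝ G]
      {f : E → F} {L : ℝ → F →L[𝕜] G},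
      ContDiffOn 𝕜 (k + 1 : ℕ) f (Metric.ball 0 ε) → Continuous L →
      ContDiffOn 𝕜 k (fun x => ∫ τ in (0 : ℝ)..1, L τ (f (D τ x))) (Metric.ball 0 ε) := by
  induction k with
  | zero =>
    intro F G _ _ _ _ _ _ f L hf hL
    refine contDiffOn_zero.2 fun x hx => ?_
    exact (hasFDerivAt_integral_contraction hDc hD1 (by simpa using hf) hL
      hx).continuousAt.continuousWithinAt
  | succ k ih =>
    intro F G _ _ _ _ _ _ f L hf hL
    have hf1 : ContDiffOn 𝕜 1 f (Metric.ball 0 ε) :=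
      hf.of_le (by exact_mod_cast Nat.le_add_left 1 (k + 1))
    have hder := fun x hx => hasFDerivAt_integral_contraction hDc hD1 hf1 hL (x := x) hx
    have hf' : ContDiffOn 𝕜 (k + 1 : ℕ) (fderiv 𝕜 f) (Metric.ball 0 ε) :=
      hf.fderiv_of_isOpen Metric.isOpen_ball (by norm_cast)
    have hL' : Continuous fun τ =>
        (ContinuousLinearMap.compL 𝕜 E F G (L τ)).comp
          ((ContinuousLinearMap.compL 𝕜 E E F).flip (D τ)) :=
      ((ContinuousLinearMap.compL 𝕜 E F G).continuous.comp hL).clm_comp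
        ((ContinuousLinearMap.compL 𝕜 E E F).flip.continuous.comp hDc)
    have hcd := ih hf' hL'
    push_cast
    rw [contDiffOn_succ_iff_fderiv_of_isOpen Metric.isOpen_ball]
    refine ⟨fun x hx => (hder x hx).differentiableAt.differentiableWithinAt, by simp, ?_⟩
    exact hcd.congr fun x hx => (hder x hx).fderiv

/-- The power series of `f` is integrated term by term. Composing a coefficient with the
contractions `D τ` does not increase its norm, so the integrated coefficients are at most `C * ‖p
k‖` and the series keeps its radius. -/
theorem analyticAt_integral_contraction [CompleteSpace E] {D : ℝ → E →L[𝕜] E}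
    (hDc : Continuous D) (hD1 : ∀ τ ∈ Set.Icc (0 : ℝ) 1, ∀ x, ‖D τ x‖ ≤ ‖x‖)
    {f : E → 𝕜} (hf : AnalyticAt 𝕜 f 0) {a : ℝ → 𝕜} (ha : Continuous a)  :
    AnalyticAt 𝕜 (fun x => ∫ τ in (0 : ℝ)..1, a τ * f (D τ x)) 0 := by
  obtain ⟨p, R, hp⟩ := hf
  obtain ⟨C, hC⟩ := isCompact_Icc.exists_bound_of_continuousOn
    (s := Set.Icc (0 : ℝ) 1) ha.continuousOn
  have hC0 : 0 ≤ C := (norm_nonneg _).trans (hC 0 (by simp))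
  have hI : Set.uIoc (0 : ℝ) 1 ⊆ Set.Icc 0 1 := by
    rw [Set.uIoc_of_le zero_le_one]
    exact Set.Ioc_subset_Icc_self
  have hDn : ∀ τ ∈ Set.Icc (0 : ℝ) 1, ‖D τ‖ ≤ 1 := fun τ hτ =>
    (D τ).opNorm_le_bound zero_le_one fun x => by simpa using hD1 τ hτ x
  let Q : ∀ k, ℝ → ContinuousMultilinearMap 𝕜 (fun _ : Fin k => E) 𝕜 := fun k τ =>
    a τ • (p k).compContinuousLinearMap fun _ => D τ
  have hQc : ∀ k, Continuous (Q k) := by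
    intro k
    refine ha.smul ?_
    have h1 : Continuous fun τ =>
        ContinuousMultilinearMap.compContinuousLinearMapContinuousMultilinear 𝕜
          (fun _ : Fin k => E) (fun _ => E) 𝕜 (fun _ => D τ) :=
      (ContinuousMultilinearMap.cont _).comp (continuous_pi fun _ => hDc)
    exact h1.clm_apply continuous_const
  have hQi : ∀ k, IntervalIntegrable (Q k) MeasureTheory.volume 0 1 := fun k =>
    (hQc k).intervalIntegrable _ _
  have hQn : ∀ k, ∀ τ ∈ Set.Icc (0 : ℝ) 1, ‖Q k τ‖ ≤ C * ‖p k‖ := by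
    intro k τ hτ
    refine (norm_smul_le (a τ) ((p k).compContinuousLinearMap fun _ => D τ)).trans ?_
    refine mul_le_mul (hC τ hτ) ?_ (norm_nonneg _) hC0
    refine ((p k).norm_compContinuousLinearMap_le _).trans ?_
    refine mul_le_of_le_one_right (norm_nonneg _) ?_
    exact Finset.prod_le_one (fun _ _ => norm_nonneg _) fun _ _ => hDn τ hτ
  let q : FormalMultilinearSeries 𝕜 E 𝕜 := fun k => ∫ τ in (0 : ℝ)..1, Q k τ
  have hqn : ∀ k, ‖q k‖ ≤ C * ‖p k‖ := by
    intro k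
    have := intervalIntegral.norm_integral_le_of_norm_le_const (a := 0) (b := 1) (f := Q k)
      (C := C * ‖p k‖) fun τ hτ => hQn k τ (hI hτ)
    simpa using this
  have hrad : R ≤ q.radius := by
    refine ENNReal.le_of_forall_nnreal_lt fun ρ hρ => ?_
    obtain ⟨K, hK, hb⟩ := p.norm_mul_pow_le_of_lt_radius (hρ.trans_le hp.r_le)
    refine q.le_radius_of_bound (C * K) fun k => ?_
    calc ‖q k‖ * (ρ : ℝ) ^ k ≤ (C * ‖p k‖) * (ρ : ℝ) ^ k :=
          mul_le_mul_of_nonneg_right (hqn k) (by positivity)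
      _ = C * (‖p k‖ * (ρ : ℝ) ^ k) := by ring
      _ ≤ C * K := mul_le_mul_of_nonneg_left (hb k) hC0
  refine ⟨q, R, hrad, hp.r_pos, fun {y} hy => ?_⟩
  simp only [zero_add]
  have hyr : (‖y‖₊ : ENNReal) < p.radius := by
    have : (‖y‖₊ : ENNReal) < R := by simpa [enorm_eq_nnnorm] using hy
    exact this.trans_le hp.r_le
  have hsum : Summable fun k => C * (‖p k‖ * ‖y‖ ^ k) :=
    (p.summable_norm_mul_pow hyr).mul_left C
  have hqy : ∀ k, q k (fun _ => y) = ∫ τ in (0 : ℝ)..1, Q k τ fun _ => y := by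
    intro k
    exact ((ContinuousMultilinearMap.apply 𝕜 (fun _ : Fin k => E) 𝕜
      (fun _ => y)).intervalIntegral_comp_comm (hQi k)).symm
  simp only [hqy]
  refine intervalIntegral.hasSum_integral_of_dominated_convergence
    (fun k _ => C * (‖p k‖ * ‖y‖ ^ k)) ?_ ?_ ?_ ?_ ?_
  · intro k
    have : Continuous fun τ => Q k τ fun _ => y :=
      (ContinuousMultilinearMap.apply 𝕜 (fun _ : Fin k => E) 𝕜
        (fun _ => y)).continuous.comp (hQc k)
    exact this.aestronglyMeasurable
  · refine fun k => Eventually.of_forall fun τ hτ => ?_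
    refine ((Q k τ).le_opNorm _).trans ?_
    simp only [Finset.prod_const, Finset.card_univ, Fintype.card_fin]
    rw [← mul_assoc]
    exact mul_le_mul_of_nonneg_right (hQn k τ (hI hτ)) (by positivity)
  · exact Eventually.of_forall fun _ _ => hsum
  · exact intervalIntegrable_const
  · refine Eventually.of_forall fun τ hτ => ?_
    have hmem : D τ y ∈ Metric.eball (0 : E) R := by
      have h1 : (‖y‖₊ : ENNReal) < R := by simpa [enorm_eq_nnnorm] using hy
      have h2 : ‖D τ y‖₊ ≤ ‖y‖₊ := hD1 τ (hI hτ) y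
      have h3 : (‖D τ y‖₊ : ENNReal) < R := lt_of_le_of_lt (by exact_mod_cast h2) h1
      simpa [enorm_eq_nnnorm] using h3
    have := (hp.hasSum hmem).mul_left (a τ)
    simpa [Q] using this

theorem regularNear_integral_contraction [ProperSpace E] {D : ℝ → E →L[𝕜] E}
    {m : WithTop ℕ∞} (hm : m = ∞ ∨ m = ω)
    (hDc : Continuous D) (hD1 : ∀ τ ∈ Set.Icc (0 : ℝ) 1, ∀ x, ‖D τ x‖ ≤ ‖x‖)
    {f : E → 𝕜} (hf : RegularNear 𝕜 m f 0) {a : ℝ → 𝕜} (ha : Continuous a) :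
    RegularNear 𝕜 m (fun x => ∫ τ in (0 : ℝ)..1, a τ * f (D τ x)) 0 := by
  rcases hm with rfl | rfl
  · obtain ⟨ε, hε, hball⟩ := Metric.eventually_nhds_iff_ball.1 hf
    have hL : Continuous fun τ => a τ • ContinuousLinearMap.id 𝕜 𝕜 := ha.smul continuous_const
    filter_upwards [Metric.ball_mem_nhds (0 : E) hε] with x hx
    refine contDiffAt_infty.2 fun k => ?_
    have h1 : ContDiffOn 𝕜 (k + 1 : ℕ) f (Metric.ball 0 ε) := fun y hy =>
      ((hball y hy).of_le (by exact_mod_cast le_top)).contDiffWithinAt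
    have h2 := contDiffOn_integral_contraction hDc hD1 k h1 hL
    exact h2.contDiffAt (Metric.isOpen_ball.mem_nhds hx)
  · have := analyticAt_integral_contraction hDc hD1 hf.contDiffAt.analyticAt ha
    exact this.eventually_analyticAt.mono fun x hx => hx.contDiffAt

end Integral

end SymGerm

namespace SymGerm

/-! ### Weighted homogeneity: radial primitives and the Euler relation. -/

section Weighted

variable {𝕜 : Type} [RCLike 𝕜] {r : ℕ}

theorem hasDerivAt_ofReal_pow (j : ℕ) (τ : ℝ) :
    HasDerivAt (fun τ : ℝ => (τ : 𝕜) ^ j) (j * (τ : 𝕜) ^ (j - 1)) τ := by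
  have h : HasDerivAt (fun τ : ℝ => (τ : 𝕜)) 1 τ := by
    simpa using (RCLike.ofRealCLM (K := 𝕜)).hasDerivAt (x := τ)
  exact (h.pow j).congr_deriv (by simp)

theorem norm_exp_le_exp_norm (c : 𝕜) : ‖NormedSpace.exp c‖ ≤ Real.exp ‖c‖ := by
  have h := NormedSpace.expSeries_div_hasSum_exp ‖c‖
  rw [← Real.exp_eq_exp_ℝ] at h
  rw [← (NormedSpace.expSeries_div_hasSum_exp c).tsum_eq]
  exact tsum_of_norm_bounded h fun i => by simp

theorem hasDerivAt_exp_ofReal_mul (c : 𝕜) (θ : ℝ) :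
    HasDerivAt (fun θ : ℝ => NormedSpace.exp ((θ : 𝕜) * c))
      (c * NormedSpace.exp ((θ : 𝕜) * c)) θ := by
  have h : HasDerivAt (fun τ : ℝ => (τ : 𝕜) * c) c θ := by
    simpa using ((RCLike.ofRealCLM (K := 𝕜)).hasDerivAt (x := θ)).mul_const c
  exact (hasDerivAt_exp (𝕂 := 𝕜) (x := (θ : 𝕜) * c)).scomp θ h

/-- The chain rule along a curve for a `𝕜`-differentiable function. -/
theorem hasDerivAt_comp_curve {b : (Fin r → 𝕜) → 𝕜} {γ : ℝ → Fin r → 𝕜} {γ' : Fin r → 𝕜}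
    {τ : ℝ} (hb : DifferentiableAt 𝕜 b (γ τ)) (hγ : HasDerivAt γ γ' τ) :
    HasDerivAt (fun τ => b (γ τ)) (fderiv 𝕜 b (γ τ) γ') τ :=
  (hb.hasFDerivAt.restrictScalars ℝ).comp_hasDerivAt τ hγ

/-- This turns the velocity of `c ↦ (c ^ w_k x_k)` into the Euler field at the moving point. Weight
`0` is treated apart because `w k - 1` is truncated there. -/
theorem smul_weighted_deriv (w : Fin r → ℕ) (c : 𝕜) (x : Fin r → 𝕜) :
    (c • fun k => ((w k : 𝕜) * c ^ (w k - 1)) * x k) = fun k => (w k : 𝕜) * (c ^ w k * x k) := by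
  funext k
  rcases Nat.eq_zero_or_pos (w k) with h | h
  · simp [h]
  · obtain ⟨j, hj⟩ := Nat.exists_eq_succ_of_ne_zero h.ne'
    simp only [Pi.smul_apply, smul_eq_mul, hj, Nat.succ_eq_add_one, Nat.add_sub_cancel]
    ring

/-- Every function germ `ρ` is of the form `W R + E R`, where `E = ∑ w_k x_k ∂_k` is the Euler
vector field and `W = ∑ w_k > 0`. -/
theorem exists_radial_primitive {m : WithTop ℕ∞} (hm : m = ∞ ∨ m = ω) (w : Fin r → ℕ)
    (hw : 0 < ∑ k, w k) {ρ : (Fin r → 𝕜) → 𝕜} (hρ : RegularNear 𝕜 m ρ 0) :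
    ∃ R : (Fin r → 𝕜) → 𝕜, RegularNear 𝕜 m R 0 ∧
      ∀ᶠ x in 𝓝 0, ((∑ k, w k : ℕ) : 𝕜) * R x + fderiv 𝕜 R x (fun k => (w k : 𝕜) * x k) = ρ x := by
  have hm1 : (1 : WithTop ℕ∞) ≤ m := by rcases hm with rfl | rfl <;> simp
  set W := ∑ k, w k with hW
  obtain ⟨W', hW'⟩ := Nat.exists_eq_succ_of_ne_zero hw.ne'
  rw [Nat.succ_eq_add_one] at hW'
  let D : ℝ → (Fin r → 𝕜) →L[𝕜] (Fin r → 𝕜) := fun τ =>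
    ContinuousLinearMap.mul 𝕜 (Fin r → 𝕜) fun k => (τ : 𝕜) ^ w k
  have hDapp : ∀ τ x, D τ x = fun k => (τ : 𝕜) ^ w k * x k := fun τ x => rfl
  have hDc : Continuous D := by
    refine (ContinuousLinearMap.mul 𝕜 (Fin r → 𝕜)).continuous.comp ?_
    exact continuous_pi fun k => RCLike.continuous_ofReal.pow _
  have hD1 : ∀ τ ∈ Set.Icc (0 : ℝ) 1, ∀ x, ‖D τ x‖ ≤ ‖x‖ := by
    intro τ hτ x
    rw [hDapp, pi_norm_le_iff_of_nonneg (norm_nonneg x)]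
    intro k
    rw [norm_mul, norm_pow, RCLike.norm_ofReal, abs_of_nonneg hτ.1]
    exact (mul_le_of_le_one_left (norm_nonneg _) (pow_le_one₀ hτ.1 hτ.2)).trans (norm_le_pi_norm x k)
  have ha : Continuous fun τ : ℝ => (τ : 𝕜) ^ W' := RCLike.continuous_ofReal.pow _
  -- Here `W' = W - 1`. The integrand of `W R + E R` is the `τ`-derivative of `τ ^ W * ρ (D τ x)`,
  -- whose value at `τ = 0` vanishes because `W > 0`.
  refine ⟨fun x => ∫ τ in (0 : ℝ)..1, (τ : 𝕜) ^ W' * ρ (D τ x),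
    regularNear_integral_contraction hm hDc hD1 hρ ha, ?_⟩
  obtain ⟨ε, hε, hball⟩ := Metric.eventually_nhds_iff_ball.1 hρ
  have hρ1 : ContDiffOn 𝕜 1 ρ (Metric.ball 0 ε) := fun y hy =>
    ((hball y hy).of_le hm1).contDiffWithinAt
  have hL : Continuous fun τ : ℝ => (τ : 𝕜) ^ W' • ContinuousLinearMap.id 𝕜 𝕜 :=
    ha.smul continuous_const
  have hfd : ContinuousOn (fderiv 𝕜 ρ) (Metric.ball 0 ε) :=
    hρ1.continuousOn_fderiv_of_isOpen Metric.isOpen_ball le_rfl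
  filter_upwards [Metric.ball_mem_nhds (0 : Fin r → 𝕜) hε] with x hx
  have hmem : ∀ τ ∈ Set.Icc (0 : ℝ) 1, D τ x ∈ Metric.ball (0 : Fin r → 𝕜) ε := fun τ hτ =>
    mem_ball_of_contraction hD1 hτ hx
  have hdc : ContinuousOn (fun τ => fderiv 𝕜 ρ (D τ x)) (Set.Icc 0 1) :=
    hfd.comp (hDc.clm_apply continuous_const).continuousOn hmem
  have hρc : ContinuousOn (fun τ => ρ (D τ x)) (Set.Icc 0 1) :=
    hρ1.continuousOn.comp (hDc.clm_apply continuous_const).continuousOn hmem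
  set v : Fin r → 𝕜 := fun k => (w k : 𝕜) * x k with hv
  have hder := hasFDerivAt_integral_contraction hDc hD1 hρ1 hL hx
  have hfderiv : fderiv 𝕜 (fun x => ∫ τ in (0 : ℝ)..1, (τ : 𝕜) ^ W' * ρ (D τ x)) x v =
      ∫ τ in (0 : ℝ)..1, (τ : 𝕜) ^ W' * fderiv 𝕜 ρ (D τ x) (D τ v) := by
    have h1 : HasFDerivAt (fun x => ∫ τ in (0 : ℝ)..1, (τ : 𝕜) ^ W' * ρ (D τ x)) _ x := hder
    rw [h1.fderiv, ContinuousLinearMap.intervalIntegral_apply]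
    · rfl
    · refine ContinuousOn.intervalIntegrable ?_
      rw [Set.uIcc_of_le zero_le_one]
      exact hL.continuousOn.clm_comp (hdc.clm_comp hDc.continuousOn)
  have hi1 : IntervalIntegrable (fun τ : ℝ => (τ : 𝕜) ^ W' * ρ (D τ x)) MeasureTheory.volume 0 1 := by
    refine ContinuousOn.intervalIntegrable ?_
    rw [Set.uIcc_of_le zero_le_one]
    exact ha.continuousOn.mul hρc
  have hi2 : IntervalIntegrable (fun τ : ℝ => (τ : 𝕜) ^ W' * fderiv 𝕜 ρ (D τ x) (D τ v))
      MeasureTheory.volume 0 1 := by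
    refine ContinuousOn.intervalIntegrable ?_
    rw [Set.uIcc_of_le zero_le_one]
    exact ha.continuousOn.mul (hdc.clm_apply (hDc.clm_apply continuous_const).continuousOn)
  have hFTC := intervalIntegral.integral_eq_sub_of_hasDerivAt (a := 0) (b := 1)
    (f := fun τ : ℝ => (τ : 𝕜) ^ W * ρ (D τ x))
    (f' := fun τ : ℝ => (W : 𝕜) * ((τ : 𝕜) ^ W' * ρ (D τ x)) +
      (τ : 𝕜) ^ W' * fderiv 𝕜 ρ (D τ x) (D τ v)) (by
      intro τ hτ
      rw [Set.uIcc_of_le zero_le_one] at hτ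
      have h1 : HasDerivAt (fun τ : ℝ => D τ x)
          (fun k => ((w k : 𝕜) * (τ : 𝕜) ^ (w k - 1)) * x k) τ :=
        hasDerivAt_pi.2 fun k => (hasDerivAt_ofReal_pow (w k) τ).mul_const (x k)
      have h2 := hasDerivAt_comp_curve ((hball _ (hmem τ hτ)).differentiableAt
        (by rintro rfl; simp at hm1)) h1
      have h3 := (hasDerivAt_ofReal_pow (𝕜 := 𝕜) W τ).mul h2
      refine h3.congr_deriv ?_
      have h4 : D τ v = (τ : 𝕜) • fun k => ((w k : 𝕜) * (τ : 𝕜) ^ (w k - 1)) * x k := by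
        rw [smul_weighted_deriv, hDapp, hv]
        funext k
        ring
      rw [h4, map_smul, smul_eq_mul, hW', Nat.add_sub_cancel]
      ring) ((hi1.const_mul _).add hi2)
  rw [intervalIntegral.integral_add (hi1.const_mul _) hi2,
    intervalIntegral.integral_const_mul] at hFTC
  rw [hfderiv, hFTC]
  simp [hDapp, hw.ne']

/-- A function which is quasi-homogeneous as a germ, for every dilation separately, satisfies the
Euler relation near `0`. -/
theorem euler_of_quasiHomogeneous (w : Fin r → ℕ) (d : ℝ) {b : (Fin r → 𝕜) → 𝕜}
    (hb : ∀ᶠ x in 𝓝 0, DifferentiableAt 𝕜 b x)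
    (hh : ∀ t : ℝ, 0 < t → ∀ᶠ x in 𝓝 (0 : Fin r → 𝕜),
      b (fun k => (t : 𝕜) ^ w k * x k) = ((t ^ d : ℝ) : 𝕜) * b x) :
    ∀ᶠ x in 𝓝 0, fderiv 𝕜 b x (fun k => (w k : 𝕜) * x k) = (d : 𝕜) * b x := by
  obtain ⟨ε, hε, hball⟩ := Metric.eventually_nhds_iff_ball.1 hb
  set M := ∑ k, w k with hM
  -- For `t ∈ [1, 2]` each factor `t ^ w k` is at most `2 ^ M`, so the ball of radius `δ` is dilated
  -- into the ball where `b` is differentiable.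
  set δ : ℝ := ε / 2 ^ M with hδ
  have hδ0 : 0 < δ := by positivity
  have hmem : ∀ t ∈ Set.Icc (1 : ℝ) 2, ∀ y : Fin r → 𝕜, ‖y‖ < δ →
      (fun k => (t : 𝕜) ^ w k * y k) ∈ Metric.ball (0 : Fin r → 𝕜) ε := by
    intro t ht y hy
    rw [mem_ball_zero_iff, pi_norm_lt_iff hε]
    intro k
    rw [norm_mul, norm_pow, RCLike.norm_ofReal, abs_of_nonneg (zero_le_one.trans ht.1)]
    have h1 : t ^ w k ≤ 2 ^ M :=
      (pow_le_pow_left₀ (zero_le_one.trans ht.1) ht.2 _).trans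
        (pow_le_pow_right₀ one_le_two (Finset.single_le_sum (fun _ _ => Nat.zero_le _)
          (Finset.mem_univ k)))
    calc t ^ w k * ‖y k‖ ≤ 2 ^ M * ‖y‖ :=
          mul_le_mul h1 (norm_le_pi_norm y k) (norm_nonneg _) (by positivity)
      _ < 2 ^ M * δ := by gcongr
      _ = ε := by rw [hδ]; field_simp
  have hγ : ∀ (t : ℝ) (y : Fin r → 𝕜), HasDerivAt (fun t : ℝ => fun k => (t : 𝕜) ^ w k * y k)
      (fun k => ((w k : 𝕜) * (t : 𝕜) ^ (w k - 1)) * y k) t := fun t y =>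
    hasDerivAt_pi.2 fun k => (hasDerivAt_ofReal_pow (w k) t).mul_const (y k)
  let good : ℝ → (Fin r → 𝕜) → Prop := fun t y =>
    b (fun k => (t : 𝕜) ^ w k * y k) = ((t ^ d : ℝ) : 𝕜) * b y
  -- Inside `[1, 2]`, `C N` collects the `t` whose relation holds on a ball of radius governed by
  -- `N`; the two half-lines are added so that the closed sets `C N` cover `ℝ`.
  let C : ℕ → Set ℝ := fun N => ⋂ (y : Fin r → 𝕜) (_ : ‖y‖ < δ) (_ : ‖y‖ < 1 / ((N : ℝ) + 1)),
    (Set.Iic 1 ∪ Set.Ici 2) ∪ {t | t ∈ Set.Icc (1 : ℝ) 2 ∧ good t y}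
  have hC : ∀ N, IsClosed (C N) := by
    intro N
    refine isClosed_iInter fun y => isClosed_iInter fun hy => isClosed_iInter fun _ => ?_
    refine (isClosed_Iic.union isClosed_Ici).union ?_
    have h1 : ContinuousOn (fun t : ℝ => b (fun k => (t : 𝕜) ^ w k * y k) -
        ((t ^ d : ℝ) : 𝕜) * b y) (Set.Icc 1 2) := by
      intro t ht
      have ht0 : t ≠ 0 := (zero_lt_one.trans_le ht.1).ne'
      refine ContinuousAt.continuousWithinAt (ContinuousAt.sub ?_ ?_)
      · exact (hasDerivAt_comp_curve (hball _ (hmem t ht y hy)) (hγ t y)).continuousAt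
      · exact (RCLike.continuous_ofReal.continuousAt.comp
          (Real.continuousAt_rpow_const t d (Or.inl ht0))).mul continuousAt_const
    have h2 := h1.preimage_isClosed_of_isClosed isClosed_Icc (isClosed_singleton (x := (0 : 𝕜)))
    convert h2 using 1
    ext t
    simp [good, sub_eq_zero]
  have hU : ⋃ N, C N = Set.univ := by
    refine Set.eq_univ_of_forall fun t => ?_
    by_cases ht : t ∈ Set.Icc (1 : ℝ) 2
    · obtain ⟨η, hη, hηb⟩ := Metric.eventually_nhds_iff_ball.1
        (hh t (zero_lt_one.trans_le ht.1))
      obtain ⟨N, hN⟩ := exists_nat_one_div_lt hη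
      refine Set.mem_iUnion.2 ⟨N, ?_⟩
      simp only [C, Set.mem_iInter]
      intro y _ hy
      exact Or.inr ⟨ht, hηb y (mem_ball_zero_iff.2 (hy.trans hN))⟩
    · refine Set.mem_iUnion.2 ⟨0, ?_⟩
      simp only [C, Set.mem_iInter]
      intro y _ _
      rw [Set.mem_Icc, not_and_or, not_le, not_le] at ht
      exact Or.inl (ht.imp le_of_lt le_of_lt)
  -- By Baire some `C N` has an interior point `t₀` in `(1, 2)`: near `t₀` the relation holds on one
  -- ball common to all `t`, and can be differentiated in `t`.
  obtain ⟨t₀, ht₀, ht₀'⟩ := (dense_iUnion_interior_of_closed hC hU).exists_mem_open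
    (isOpen_Ioo (a := (1 : ℝ)) (b := 2)) (Set.nonempty_Ioo.2 one_lt_two)
  obtain ⟨N, hN⟩ := Set.mem_iUnion.1 ht₀
  have hpos : 0 < t₀ := zero_lt_one.trans ht₀'.1
  have hc0 : (t₀ : 𝕜) ≠ 0 := by exact_mod_cast hpos.ne'
  have hloc : ∀ y : Fin r → 𝕜, ‖y‖ < δ → ‖y‖ < 1 / ((N : ℝ) + 1) →
      ∀ᶠ t in 𝓝 t₀, good t y := by
    intro y hy hy'
    filter_upwards [mem_interior_iff_mem_nhds.1 hN, isOpen_Ioo.mem_nhds ht₀'] with t ht ht'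
    simp only [C, Set.mem_iInter] at ht
    rcases ht y hy hy' with (h | h) | h
    · exact absurd ht'.1 (not_lt.2 h)
    · exact absurd ht'.2 (not_lt.2 h)
    · exact h.2
  -- Differentiating at `t₀` gives the Euler relation at the dilated point, so `x` is first pulled
  -- back by the `t₀`-dilation.
  let z : (Fin r → 𝕜) → Fin r → 𝕜 := fun x k => ((t₀ : 𝕜) ^ w k)⁻¹ * x k
  have hz : Tendsto z (𝓝 0) (𝓝 0) := by
    have : Continuous z := by fun_prop
    simpa [z] using this.tendsto' 0 0 (by funext k; simp [z])
  have hz1 : ∀ᶠ x in 𝓝 0, ‖z x‖ < min δ (1 / ((N : ℝ) + 1)) := by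
    have := hz.eventually (Metric.ball_mem_nhds (0 : Fin r → 𝕜)
      (lt_min hδ0 (by positivity : (0 : ℝ) < 1 / ((N : ℝ) + 1))))
    simpa using this
  filter_upwards [hz1] with x hx
  have hxz : x = fun k => (t₀ : 𝕜) ^ w k * z x k := by
    funext k
    simp only [z]
    rw [mul_inv_cancel_left₀ (pow_ne_zero _ hc0)]
  obtain ⟨hx1, hx2⟩ := lt_min_iff.1 hx
  generalize z x = y at *
  have hg := hloc y hx1 hx2
  have hd1 := hasDerivAt_comp_curve
    (hball _ (hmem t₀ (Set.Ioo_subset_Icc_self ht₀') y hx1)) (hγ t₀ y)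
  have hd2 : HasDerivAt (fun t : ℝ => ((t ^ d : ℝ) : 𝕜) * b y)
      (((d * t₀ ^ (d - 1) : ℝ) : 𝕜) * b y) t₀ := by
    have h1 := Real.hasDerivAt_rpow_const (x := t₀) (p := d) (Or.inl hpos.ne')
    have h2 := (RCLike.ofRealCLM (K := 𝕜)).hasFDerivAt.comp_hasDerivAt t₀ h1
    exact HasDerivAt.mul_const h2 (b y)
  have hEq := (hd1.congr_of_eventuallyEq (hg.mono fun t ht => ht.symm)).unique hd2
  have hval : b x = ((t₀ ^ d : ℝ) : 𝕜) * b y := by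
    rw [hxz]
    exact hg.self_of_nhds
  have hvec : (fun k => (w k : 𝕜) * x k) =
      (t₀ : 𝕜) • fun k => ((w k : 𝕜) * (t₀ : 𝕜) ^ (w k - 1)) * y k := by
    rw [smul_weighted_deriv, hxz]
  rw [hval, hvec, map_smul, smul_eq_mul]
  rw [← hxz] at hEq
  rw [hEq, Real.rpow_sub_one hpos.ne']
  push_cast
  field_simp

/-- Integrated form of the Euler relation, uniform for bounded scaling exponents. -/
theorem scaling_of_euler (w : Fin r → ℕ) (d : 𝕜) {b : (Fin r → 𝕜) → 𝕜}
    (hb : ∀ᶠ x in 𝓝 0, DifferentiableAt 𝕜 b x)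
    (he : ∀ᶠ x in 𝓝 0, fderiv 𝕜 b x (fun k => (w k : 𝕜) * x k) = d * b x) (S : ℝ) :
    ∀ᶠ x in 𝓝 (0 : Fin r → 𝕜), ∀ s : 𝕜, ‖s‖ ≤ S →
      b (fun k => NormedSpace.exp (s * w k) * x k) = NormedSpace.exp (s * d) * b x := by
  obtain ⟨ε, hε, hball⟩ := Metric.eventually_nhds_iff_ball.1 (hb.and he)
  set M := ∑ k, w k with hM
  set δ : ℝ := ε / Real.exp (S * M) with hδ
  have hδ0 : 0 < δ := by positivity
  filter_upwards [Metric.ball_mem_nhds (0 : Fin r → 𝕜) hδ0] with x hx s hs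
  rw [mem_ball_zero_iff] at hx
  let γ : ℝ → Fin r → 𝕜 := fun θ k => NormedSpace.exp ((θ : 𝕜) * (s * w k)) * x k
  have hmem : ∀ θ ∈ Set.Icc (0 : ℝ) 1, γ θ ∈ Metric.ball (0 : Fin r → 𝕜) ε := by
    intro θ hθ
    rw [mem_ball_zero_iff, pi_norm_lt_iff hε]
    intro k
    have h0 : ‖NormedSpace.exp ((θ : 𝕜) * (s * w k))‖ ≤ Real.exp (S * M) := by
      refine (norm_exp_le_exp_norm _).trans (Real.exp_le_exp.2 ?_)
      rw [norm_mul, norm_mul, RCLike.norm_ofReal, abs_of_nonneg hθ.1, RCLike.norm_natCast]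
      have h1 : (w k : ℝ) ≤ M := by
        exact_mod_cast Finset.single_le_sum (f := w) (fun _ _ => Nat.zero_le _) (Finset.mem_univ k)
      have h2 : ‖s‖ * (w k : ℝ) ≤ S * M :=
        mul_le_mul hs h1 (Nat.cast_nonneg _) ((norm_nonneg _).trans hs)
      exact (mul_le_of_le_one_left (by positivity) hθ.2).trans h2
    simp only [γ, norm_mul]
    calc ‖NormedSpace.exp ((θ : 𝕜) * (s * w k))‖ * ‖x k‖ ≤ Real.exp (S * M) * ‖x‖ :=
          mul_le_mul h0 (norm_le_pi_norm x k) (norm_nonneg _) (Real.exp_pos _).le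
      _ < Real.exp (S * M) * δ := by gcongr
      _ = ε := by rw [hδ]; field_simp
  have hγ : ∀ θ, HasDerivAt γ (s • fun k => (w k : 𝕜) * γ θ k) θ := by
    intro θ
    refine hasDerivAt_pi.2 fun k => ?_
    refine ((hasDerivAt_exp_ofReal_mul (s * w k) θ).mul_const (x k)).congr_deriv ?_
    simp only [γ, Pi.smul_apply, smul_eq_mul]
    ring
  -- By the Euler relation `exp (-θ s d) b` is constant along the curve `γ` from `x` to its dilate.
  -- The real parameter `θ` allows `s` to be complex.
  have hφ : ∀ θ ∈ Set.Icc (0 : ℝ) 1,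
      HasDerivAt (fun θ : ℝ => NormedSpace.exp ((θ : 𝕜) * (-(s * d))) * b (γ θ)) 0 θ := by
    intro θ hθ
    obtain ⟨h1, h2⟩ := hball _ (hmem θ hθ)
    refine ((hasDerivAt_exp_ofReal_mul (-(s * d)) θ).mul
      (hasDerivAt_comp_curve h1 (hγ θ))).congr_deriv ?_
    rw [map_smul, h2, smul_eq_mul]
    ring
  have hconst := constant_of_has_deriv_right_zero
    (fun θ hθ => (hφ θ hθ).continuousAt.continuousWithinAt)
    (fun θ hθ => (hφ θ (Set.Ico_subset_Icc_self hθ)).hasDerivWithinAt) 1 (by simp)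
  simp only [γ, RCLike.ofReal_one, RCLike.ofReal_zero, one_mul, zero_mul, NormedSpace.exp_zero]
    at hconst
  rw [← hconst, ← mul_assoc, ← NormedSpace.exp_add, add_neg_cancel, NormedSpace.exp_zero, one_mul]

end Weighted

end SymGerm

namespace SymGerm

/-! ### Dilations with variable exponent and the equation for densities. -/

section Dilation

variable {𝕜 : Type} [RCLike 𝕜] {r : ℕ} {m : WithTop ℕ∞}

/-- The weighted dilation `(x_k) ↦ (exp (s w_k) x_k)`. -/
noncomputable def dilate (w : Fin r → ℕ) (s : 𝕜) (x : Fin r → 𝕜) : Fin r → 𝕜 :=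
  fun k => NormedSpace.exp (s * w k) * x k

/-- The Euler vector field `∑ w_k x_k ∂_k`. -/
noncomputable def eulerField (w : Fin r → ℕ) (x : Fin r → 𝕜) : Fin r → 𝕜 :=
  fun k => (w k : 𝕜) * x k

theorem dilate_zero_right (w : Fin r → ℕ) (s : 𝕜) : dilate w s 0 = 0 := by
  funext k
  simp [dilate]

theorem dilate_zero_left (w : Fin r → ℕ) (x : Fin r → 𝕜) : dilate w 0 x = x := by
  funext k
  simp [dilate]

theorem RegularNear.dilate {E : Type} [NormedAddCommGroup E] [NormedSpace 𝕜 E]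
    (w : Fin r → ℕ) {s : E → 𝕜} {f : E → Fin r → 𝕜} {a : E} (hs : RegularNear 𝕜 m s a)
    (hf : RegularNear 𝕜 m f a) : RegularNear 𝕜 m (fun x => SymGerm.dilate w (s x) (f x)) a :=
  RegularNear.pi fun k => by
    have h : RegularNear 𝕜 m (fun x => s x * (w k : 𝕜)) a := by
      filter_upwards [hs] with x hx using hx.mul contDiffAt_const
    exact h.exp.mul (hf.apply k)

/-- The derivative of `x ↦ dilate w (g x) x`, when `g` has derivative `g'`. -/
noncomputable def dilateDeriv (w : Fin r → ℕ) (s : 𝕜) (g' : (Fin r → 𝕜) →L[𝕜] 𝕜) (x : Fin r → 𝕜) :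
    (Fin r → 𝕜) →L[𝕜] (Fin r → 𝕜) :=
  ContinuousLinearMap.pi fun k => NormedSpace.exp (s * w k) •
    (ContinuousLinearMap.proj k + ((w k : 𝕜) * x k) • g')

theorem dilateDeriv_apply (w : Fin r → ℕ) (s : 𝕜) (g' : (Fin r → 𝕜) →L[𝕜] 𝕜)
    (x v : Fin r → 𝕜) (k : Fin r) :
    dilateDeriv w s g' x v k = NormedSpace.exp (s * w k) * (v k + (w k : 𝕜) * x k * g' v) := by
  simp [dilateDeriv]
  ring

theorem hasFDerivAt_dilate (w : Fin r → ℕ) {g : (Fin r → 𝕜) → 𝕜}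
    {g' : (Fin r → 𝕜) →L[𝕜] 𝕜} {x : Fin r → 𝕜} (hg : HasFDerivAt g g' x) :
    HasFDerivAt (fun x => dilate w (g x) x) (dilateDeriv w (g x) g' x) x := by
  refine hasFDerivAt_pi.2 fun k => ?_
  have h1 : HasFDerivAt (fun x => g x * (w k : 𝕜)) ((w k : 𝕜) • g') x := hg.mul_const _
  have h2 := (hasDerivAt_exp (𝕂 := 𝕜) (x := g x * w k)).comp_hasFDerivAt x h1
  have h3 : HasFDerivAt (fun x : Fin r → 𝕜 => x k)
    (ContinuousLinearMap.proj k : (Fin r → 𝕜) →L[𝕜] 𝕜) x := hasFDerivAt_apply k x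
  refine (h2.mul h3).congr_fderiv ?_
  ext v
  simp
  ring

/-- A variable exponent moves points along Euler orbits, so the Euler field is merely rescaled. This
is the chain rule needed for `E (R₁ ∘ φ)`. -/
theorem dilateDeriv_eulerField (w : Fin r → ℕ) (s : 𝕜) (g' : (Fin r → 𝕜) →L[𝕜] 𝕜)
    (x : Fin r → 𝕜) :
    dilateDeriv w s g' x (eulerField w x) =
      (1 + g' (eulerField w x)) • eulerField w (dilate w s x) := by
  funext k
  simp only [dilateDeriv_apply, Pi.smul_apply, smul_eq_mul, eulerField, dilate]
  ring

/-- The Jacobian matrix is a diagonal matrix times a rank-one perturbation of the identity, so the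
matrix determinant lemma applies. -/
theorem det_dilateDeriv (w : Fin r → ℕ) (s : 𝕜) (g' : (Fin r → 𝕜) →L[𝕜] 𝕜) (x : Fin r → 𝕜) :
    (dilateDeriv w s g' x).det =
      NormedSpace.exp (s * (∑ k, w k : ℕ)) * (1 + g' (eulerField w x)) := by
  have hM : LinearMap.toMatrix' (dilateDeriv w s g' x : (Fin r → 𝕜) →ₗ[𝕜] (Fin r → 𝕜)) =
      Matrix.diagonal (fun k => NormedSpace.exp (s * w k)) *
        (1 + Matrix.replicateCol Unit (eulerField w x) *
          Matrix.replicateRow Unit fun j => g' (Pi.single j 1)) := by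
    ext i j
    rw [LinearMap.toMatrix'_apply, Matrix.diagonal_mul]
    simp only [ContinuousLinearMap.coe_coe]
    simp [dilateDeriv_apply, Matrix.mul_apply, Matrix.one_apply, eulerField, Pi.single_apply]
  rw [ContinuousLinearMap.det, ← LinearMap.det_toMatrix', hM, Matrix.det_mul,
    Matrix.det_diagonal, Matrix.det_one_add_replicateCol_mul_replicateRow]
  congr 1
  · rw [← NormedSpace.exp_sum, ← Finset.mul_sum, Nat.cast_sum]
  · congr 1
    have h : eulerField w x = ∑ j, eulerField w x j • Pi.single (M := fun _ => 𝕜) j 1 := by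
      funext k
      simp [Finset.sum_apply, Pi.single_apply]
    conv_rhs => rw [h, map_sum]
    simp [dotProduct, mul_comm]

/-- Two density germs with `ρ₀(0) = exp c • ρ₁(0)` are related by a germ of the form
`x ↦ dilate w (g x) x`. -/
theorem exists_dilation_pullback (hm : m = ∞ ∨ m = ω) (w : Fin r → ℕ) (hw : 0 < ∑ k, w k)
    {ρ₀ ρ₁ : (Fin r → 𝕜) → 𝕜} (h₀ : RegularNear 𝕜 m ρ₀ 0) (h₁ : RegularNear 𝕜 m ρ₁ 0)
    (hne : ρ₁ 0 ≠ 0) {c : 𝕜} (hc : ρ₀ 0 = NormedSpace.exp c * ρ₁ 0) :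
    ∃ g : (Fin r → 𝕜) → 𝕜, RegularNear 𝕜 m g 0 ∧ ∀ᶠ x in 𝓝 0,
      ρ₁ (dilate w (g x) x) * (fderiv 𝕜 (fun x => dilate w (g x) x) x).det = ρ₀ x := by
  have hm0 : m ≠ 0 := by rcases hm with rfl | rfl <;> simp
  obtain ⟨R₀, hR₀, hE₀⟩ := exists_radial_primitive hm w hw h₀
  obtain ⟨R₁, hR₁, hE₁⟩ := exists_radial_primitive hm w hw h₁
  set W := ∑ k, w k with hW
  have hW0 : (W : 𝕜) ≠ 0 := by exact_mod_cast hw.ne'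
  have hez : (fun k => (w k : 𝕜) * (0 : Fin r → 𝕜) k) = 0 := by
    funext k
    simp
  have hv₀ : (W : 𝕜) * R₀ 0 = ρ₀ 0 := by
    have := hE₀.self_of_nhds
    rwa [hez, map_zero, add_zero] at this
  have hv₁ : (W : 𝕜) * R₁ 0 = ρ₁ 0 := by
    have := hE₁.self_of_nhds
    rwa [hez, map_zero, add_zero] at this
  -- At the origin `R_i = ρ_i / W`, so the scalar equation there reads `exp (s W) ρ₁(0) = ρ₀(0)`,
  -- solved by `s W = c`.
  set s₀ : 𝕜 := c / W with hs₀
  let F : (Fin r → 𝕜) × 𝕜 → 𝕜 := fun p =>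
    NormedSpace.exp (p.2 * W) * R₁ (dilate w p.2 p.1) - R₀ p.1
  have hfst : RegularNear 𝕜 m (fun p : (Fin r → 𝕜) × 𝕜 => p.1) (0, s₀) :=
    regularNear_of_contDiff contDiff_fst _
  have hsnd : RegularNear 𝕜 m (fun p : (Fin r → 𝕜) × 𝕜 => p.2) (0, s₀) :=
    regularNear_of_contDiff contDiff_snd _
  have hF : RegularNear 𝕜 m F (0, s₀) := by
    have h1 : RegularNear 𝕜 m (fun p : (Fin r → 𝕜) × 𝕜 => NormedSpace.exp (p.2 * W)) (0, s₀) :=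
      RegularNear.exp (regularNear_of_contDiff (contDiff_snd.mul contDiff_const) _)
    have h2 : RegularNear 𝕜 m (fun p : (Fin r → 𝕜) × 𝕜 => R₁ (dilate w p.2 p.1)) (0, s₀) :=
      hR₁.comp_of_eq (RegularNear.dilate w hsnd hfst) (dilate_zero_right w s₀)
    have h3 : RegularNear 𝕜 m (fun p : (Fin r → 𝕜) × 𝕜 => R₀ p.1) (0, s₀) :=
      hR₀.comp_of_eq hfst rfl
    filter_upwards [h1.mul h2, h3] with p hp hp' using hp.sub hp'
  have hsW : s₀ * W = c := div_mul_cancel₀ c hW0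
  have hF0 : F (0, s₀) = 0 := by
    simp only [F, dilate_zero_right, hsW]
    apply mul_left_cancel₀ hW0
    rw [mul_zero, mul_sub, hv₀, hc, ← hv₁]
    ring
  -- Since the dilations fix the origin, this derivative is `exp (s₀ W) W R₁(0) = exp (s₀ W) ρ₁(0)`.
  have hFs : fderiv 𝕜 F (0, s₀) (0, 1) ≠ 0 := by
    have h1 := (hF.contDiffAt.differentiableAt hm0).hasFDerivAt.comp_hasDerivAt s₀
      ((hasDerivAt_const s₀ (0 : Fin r → 𝕜)).prodMk (hasDerivAt_id s₀))
    have h2 : HasDerivAt (fun s : 𝕜 => NormedSpace.exp (s * W) * R₁ 0 - R₀ 0)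
        (NormedSpace.exp (s₀ * W) * W * R₁ 0) s₀ := by
      have h3 : HasDerivAt (fun s : 𝕜 => s * (W : 𝕜)) W s₀ := by
        simpa using (hasDerivAt_id s₀).mul_const (W : 𝕜)
      exact (((hasDerivAt_exp (𝕂 := 𝕜)).comp s₀ h3).mul_const (R₁ 0)).sub_const (R₀ 0)
    have h4 : F ∘ (fun s : 𝕜 => ((0 : Fin r → 𝕜), s)) =
        fun s : 𝕜 => NormedSpace.exp (s * W) * R₁ 0 - R₀ 0 := by
      funext s
      simp [F, dilate_zero_right]
    have h5 : fderiv 𝕜 F (0, s₀) (0, 1) = NormedSpace.exp (s₀ * W) * W * R₁ 0 :=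
      HasDerivAt.unique (h4 ▸ h1 : HasDerivAt _ _ s₀) h2
    rw [h5, mul_assoc, hv₁]
    exact mul_ne_zero (NormedSpace.isUnit_exp _).ne_zero hne
  obtain ⟨g, hg0, hg, hFg⟩ := hF.exists_implicit hm0 hF0 hFs
  refine ⟨g, hg, ?_⟩
  have hφt : Tendsto (fun x => dilate w (g x) x) (𝓝 0) (𝓝 0) := by
    have h1 := (RegularNear.dilate w hg
      (regularNear_of_contDiff (𝕜 := 𝕜) contDiff_id (0 : Fin r → 𝕜))).continuousAt
    simpa only [ContinuousAt, id, dilate_zero_right] using h1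
  filter_upwards [hFg.eventually_nhds, hE₀, hφt.eventually hE₁,
    hg.eventually_differentiableAt hm0, hφt.eventually (hR₁.eventually_differentiableAt hm0)]
    with x hx hx₀ hx₁ hgx hRx
  have hφ := hasFDerivAt_dilate w hgx.hasFDerivAt
  have hexp : HasFDerivAt (fun x => NormedSpace.exp (g x * (W : 𝕜)))
      (NormedSpace.exp (g x * (W : 𝕜)) • ((W : 𝕜) • fderiv 𝕜 g x)) x :=
    (hasDerivAt_exp (𝕂 := 𝕜)).comp_hasFDerivAt x (hgx.hasFDerivAt.mul_const (W : 𝕜))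
  have hprod := hexp.mul
    (HasFDerivAt.comp (f := fun x => dilate w (g x) x) x hRx.hasFDerivAt hφ)
  -- Applying `W + E` to this identity gives `ρ₀` on the left and `exp (g W) (1 + E g) ρ₁ ∘ φ` on
  -- the right, which is `ρ₁ ∘ φ` times the Jacobian of `φ`.
  have hR₀eq : R₀ =ᶠ[𝓝 x] fun y => NormedSpace.exp (g y * W) * R₁ (dilate w (g y) y) := by
    filter_upwards [hx] with y hy
    exact (sub_eq_zero.1 hy).symm
  have hfd := (hprod.congr_of_eventuallyEq hR₀eq).fderiv
  have hval := hR₀eq.self_of_nhds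
  rw [hφ.fderiv, det_dilateDeriv, ← hW, ← hx₀, ← hx₁]
  change _ = (W : 𝕜) * R₀ x + fderiv 𝕜 R₀ x (eulerField w x)
  change ((W : 𝕜) * R₁ (dilate w (g x) x) + fderiv 𝕜 R₁ (dilate w (g x) x)
    (eulerField w (dilate w (g x) x))) * _ = _
  rw [hfd, hval]
  simp only [add_apply, smul_apply, smul_eq_mul,
    ContinuousLinearMap.comp_apply, dilateDeriv_eulerField, map_smul, Function.comp_apply]
  ring

end Dilation

end SymGerm

namespace SymGerm

/-! ### Membership in the isotropy group and construction of the isotopy. -/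

section Main

variable {𝕜 : Type} [RCLike 𝕜] {r n : ℕ} {m : WithTop ℕ∞}

theorem det_comp (f g : (Fin r → 𝕜) →L[𝕜] (Fin r → 𝕜)) : (f.comp g).det = f.det * g.det :=
  LinearMap.det_comp _ _

theorem compContinuousLinearMap_basisFun (Ω : (Fin r → 𝕜) [⋀^Fin r]→L[𝕜] 𝕜)
    (L : (Fin r → 𝕜) →L[𝕜] (Fin r → 𝕜)) :
    Ω.compContinuousLinearMap L (Pi.basisFun 𝕜 (Fin r)) =
      Ω (Pi.basisFun 𝕜 (Fin r)) * L.det := by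
  have h := Ω.toAlternatingMap.eq_smul_basis_det (Pi.basisFun 𝕜 (Fin r))
  have h1 : Ω.compContinuousLinearMap L (Pi.basisFun 𝕜 (Fin r)) =
      Ω.toAlternatingMap ((L : (Fin r → 𝕜) →ₗ[𝕜] (Fin r → 𝕜)) ∘ Pi.basisFun 𝕜 (Fin r)) := rfl
  rw [h1, h, AlternatingMap.smul_apply, Module.Basis.det_comp, Module.Basis.det_self, mul_one,
    smul_eq_mul]
  rfl

theorem ext_basisFun {Ω Ω' : (Fin r → 𝕜) [⋀^Fin r]→L[𝕜] 𝕜}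
    (h : Ω (Pi.basisFun 𝕜 (Fin r)) = Ω' (Pi.basisFun 𝕜 (Fin r))) : Ω = Ω' := by
  apply ContinuousAlternatingMap.toAlternatingMap_injective
  rw [Ω.toAlternatingMap.eq_smul_basis_det (Pi.basisFun 𝕜 (Fin r)),
    Ω'.toAlternatingMap.eq_smul_basis_det (Pi.basisFun 𝕜 (Fin r))]
  exact congrArg (· • _) h

theorem RegularNear.det_fderiv {f : (Fin r → 𝕜) → Fin r → 𝕜} {a : Fin r → 𝕜}
    (hf : RegularNear 𝕜 m f a) (hm : m + 1 ≤ m) :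
    RegularNear 𝕜 m (fun x => (fderiv 𝕜 f x).det) a := by
  simp only [ContinuousLinearMap.det, ← LinearMap.det_toMatrix']
  refine RegularNear.det fun i j => ?_
  simp only [LinearMap.toMatrix'_apply, ContinuousLinearMap.coe_coe]
  exact ((hf.fderiv_right hm).clm_apply _).apply i

theorem RegularNear.alternating_apply {E : Type} [NormedAddCommGroup E] [NormedSpace 𝕜 E]
    {Ω : E → (Fin r → 𝕜) [⋀^Fin r]→L[𝕜] 𝕜} {a : E}
    (hΩ : RegularNear 𝕜 m Ω a) (v : Fin r → Fin r → 𝕜) : RegularNear 𝕜 m (fun x => Ω x v) a := by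
  have h := regularNear_of_contDiff (m := m)
    (ContinuousAlternatingMap.apply 𝕜 (Fin r → 𝕜) 𝕜 v).contDiff (Ω a)
  exact h.comp hΩ

theorem IsDiffeoGerm.comp {Φ Ψ : (Fin r → 𝕜) → Fin r → 𝕜} (hΦ : IsDiffeoGerm m Φ)
    (hΨ : IsDiffeoGerm m Ψ) : IsDiffeoGerm m fun x => Φ (Ψ x) := by
  obtain ⟨hΦ0, hΦr, Φ', hΦ'0, hΦ'r, hΦ₁, hΦ₂⟩ := hΦ
  obtain ⟨hΨ0, hΨr, Ψ', hΨ'0, hΨ'r, hΨ₁, hΨ₂⟩ := hΨ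
  have ht : Tendsto Ψ (𝓝 0) (𝓝 0) := by simpa [ContinuousAt, hΨ0] using hΨr.continuousAt
  have ht' : Tendsto Φ' (𝓝 0) (𝓝 0) := by simpa [ContinuousAt, hΦ'0] using hΦ'r.continuousAt
  refine ⟨(congrArg Φ hΨ0).trans hΦ0, hΦr.comp_of_eq hΨr hΨ0, fun x => Ψ' (Φ' x),
    (congrArg Ψ' hΦ'0).trans hΨ'0,
    hΨ'r.comp_of_eq hΦ'r hΦ'0, ?_, ?_⟩
  · filter_upwards [hΨ₁, ht.eventually hΦ₁] with x h1 h2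
    rw [h2, h1]
  · filter_upwards [hΦ₂, ht'.eventually hΨ₂] with x h1 h2
    rw [h2, h1]

theorem isDiffeoGerm_dilate (hm : m ≠ 0) (w : Fin r → ℕ) {g : (Fin r → 𝕜) → 𝕜}
    (hg : RegularNear 𝕜 m g 0) : IsDiffeoGerm m fun x => dilate w (g x) x := by
  have hr : RegularNear 𝕜 m (fun x => dilate w (g x) x) 0 :=
    RegularNear.dilate w hg (regularNear_of_contDiff contDiff_id (0 : Fin r → 𝕜))
  have h0 : dilate w (g 0) (0 : Fin r → 𝕜) = 0 := dilate_zero_right w _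
  have hd := (hasFDerivAt_dilate w (hg.contDiffAt.differentiableAt hm).hasFDerivAt).fderiv
  obtain ⟨h, hh0, hh, hl, hr'⟩ := hr.exists_local_inverse hm (by
    intro v hv
    rw [hd] at hv
    funext k
    have hk := congrFun hv k
    rw [dilateDeriv_apply] at hk
    have he : NormedSpace.exp (g 0 * (w k : 𝕜)) ≠ 0 := (NormedSpace.isUnit_exp _).ne_zero
    simpa [he] using hk)
  simp only [h0] at hh0 hh hr'
  exact ⟨h0, hr, h, hh0, hh, hl, hr'⟩

/-- A quasi-homogeneous matrix germ is equivariant under dilations by bounded factors, uniformly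
near `0`. -/
theorem quasiHomogeneous_dilate (w : Fin r → ℕ) (δ : Fin n → ℕ)
    {B : (Fin r → 𝕜) → Matrix (Fin n) (Fin n) 𝕜} (hm : m ≠ 0) (hB : IsMatrixGerm m B)
    (hh : ∀ t : ℝ, 0 < t → ∀ i j, ∀ᶠ x in 𝓝 (0 : Fin r → 𝕜),
      B (fun k => (t : 𝕜) ^ w k * x k) i j =
        ((t ^ (((δ i : ℝ) + (δ j : ℝ)) / 2) : ℝ) : 𝕜) * B x i j) (S : ℝ) :
    ∀ᶠ x in 𝓝 (0 : Fin r → 𝕜), ∀ s : 𝕜, ‖s‖ ≤ S →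
      B x = Matrix.diagonal (fun i => NormedSpace.exp (-(s * (δ i / 2)))) * B (dilate w s x) *
        Matrix.diagonal (fun i => NormedSpace.exp (-(s * (δ i / 2)))) := by
  have key : ∀ i j, ∀ᶠ x in 𝓝 (0 : Fin r → 𝕜), ∀ s : 𝕜, ‖s‖ ≤ S →
      B (dilate w s x) i j =
        NormedSpace.exp (s * (((((δ i : ℝ) + (δ j : ℝ)) / 2 : ℝ)) : 𝕜)) * B x i j := by
    intro i j
    have hd := (hB i j).eventually_differentiableAt hm
    exact scaling_of_euler w _ hd
      (euler_of_quasiHomogeneous w _ hd fun t ht => hh t ht i j) S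
  filter_upwards [Filter.eventually_all.2 fun i => Filter.eventually_all.2 (key i)] with x hx s hs
  ext i j
  have h0 : -(s * ((δ i : 𝕜) / 2)) + s * (((((δ i : ℝ) + (δ j : ℝ)) / 2 : ℝ)) : 𝕜) +
      -(s * ((δ j : 𝕜) / 2)) = 0 := by
    push_cast
    ring
  rw [Matrix.mul_diagonal, Matrix.diagonal_mul, hx i j s hs, ← mul_assoc, ← NormedSpace.exp_add,
    mul_right_comm, ← NormedSpace.exp_add, h0, NormedSpace.exp_zero, one_mul]

/-- A dilation germ read in the coordinates of a quasi-homogeneous normal form of `A` belongs to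
the isotropy group of `A`. -/
theorem conj_dilate_mem_isotropyGroup (hm : m ≠ 0)
    {A X : (Fin r → 𝕜) → Matrix (Fin n) (Fin n) 𝕜} {ψ ψ' : (Fin r → 𝕜) → Fin r → 𝕜}
    (hA : IsMatrixGerm m A) (hX : IsGLGerm m X) (hψ0 : ψ 0 = 0) (hψ : RegularNear 𝕜 m ψ 0)
    (hψ'0 : ψ' 0 = 0) (hψ' : RegularNear 𝕜 m ψ' 0) (hl : ∀ᶠ x in 𝓝 0, ψ' (ψ x) = x)
    (hr : ∀ᶠ x in 𝓝 0, ψ (ψ' x) = x) (w : Fin r → ℕ) (δ : Fin n → ℕ)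
    (hh : ∀ t : ℝ, 0 < t → ∀ i j, ∀ᶠ x in 𝓝 (0 : Fin r → 𝕜),
      congruence X A (ψ fun k => (t : 𝕜) ^ w k * x k) i j =
        ((t ^ (((δ i : ℝ) + (δ j : ℝ)) / 2) : ℝ) : 𝕜) * congruence X A (ψ x) i j)
    {g : (Fin r → 𝕜) → 𝕜} (hg : RegularNear 𝕜 m g 0) :
    (fun x => ψ (dilate w (g (ψ' x)) (ψ' x))) ∈ isotropyGroup m A := by
  have hD₁ : IsDiffeoGerm m ψ := ⟨hψ0, hψ, ψ', hψ'0, hψ', hl, hr⟩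
  have hD₂ : IsDiffeoGerm m ψ' := ⟨hψ'0, hψ', ψ, hψ0, hψ, hr, hl⟩
  have hΦ := hD₁.comp ((isDiffeoGerm_dilate hm w hg).comp hD₂)
  refine ⟨hΦ, ?_⟩
  obtain ⟨hΦ0, hΦr, -⟩ := hΦ
  have hΦt : Tendsto (fun x => ψ (dilate w (g (ψ' x)) (ψ' x))) (𝓝 0) (𝓝 0) := by
    simpa only [ContinuousAt, hΦ0] using hΦr.continuousAt
  have hψ't : Tendsto ψ' (𝓝 0) (𝓝 0) := by simpa [ContinuousAt, hψ'0] using hψ'.continuousAt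
  have hcong : IsMatrixGerm m fun y => congruence X A (ψ y) := by
    intro i j
    have h1 := RegularNear.matrix_mul (RegularNear.matrix_mul (M := fun x => (X x)ᵀ)
      (fun i j => hX.1 j i) hA) hX.1 i j
    exact RegularNear.comp_of_eq (g := fun x => congruence X A x i j) h1 hψ hψ0
  -- Near `0` the values of `g` have norm at most `‖g 0‖ + 1`, so the uniform statement may be used
  -- with the exponent `s = g (ψ' x)` varying with `x`.
  have hscale := quasiHomogeneous_dilate w δ hm hcong hh (‖g 0‖ + 1)
  let S : (Fin r → 𝕜) → Matrix (Fin n) (Fin n) 𝕜 := fun x =>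
    Matrix.diagonal fun i => NormedSpace.exp (-(g (ψ' x) * (δ i / 2)))
  have hgψ : RegularNear 𝕜 m (fun x => g (ψ' x)) 0 := hg.comp_of_eq hψ' hψ'0
  have hS : IsMatrixGerm m S := by
    intro i j
    by_cases hij : i = j
    · subst hij
      simp only [S, Matrix.diagonal_apply_eq]
      refine RegularNear.exp ?_
      filter_upwards [hgψ] with x hx using (hx.mul contDiffAt_const).neg
    · simp only [S, Matrix.diagonal_apply_ne _ hij]
      exact regularNear_of_contDiff contDiff_const _
  have hSu : ∀ x, IsUnit (S x) := fun x =>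
    Matrix.isUnit_diagonal.2 (Pi.isUnit_iff.2 fun i => NormedSpace.isUnit_exp _)
  -- Pass to the normal form at `Φ x`, rescale by the diagonal `S x`, and return from the normal
  -- form at `x`.
  refine ⟨fun x => X (ψ (dilate w (g (ψ' x)) (ψ' x))) * S x * (X x)⁻¹, ⟨?_, ?_⟩, ?_⟩
  · exact RegularNear.matrix_mul (RegularNear.matrix_mul
      (fun i j => RegularNear.comp_of_eq (g := fun x => X x i j) (hX.1 i j) hΦr hΦ0) hS)
      (RegularNear.matrix_inv hX.1 hX.2.self_of_nhds)
  · filter_upwards [hX.2, hΦt.eventually hX.2] with x h1 h2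
    exact (h2.mul (hSu x)).mul ((Matrix.isUnit_nonsing_inv_iff).2 h1)
  · have hgn : ∀ᶠ y in 𝓝 (0 : Fin r → 𝕜), ‖g y‖ ≤ ‖g 0‖ + 1 :=
      (hg.continuousAt.norm.eventually_lt continuousAt_const (lt_add_one _)).mono
        fun _ h => h.le
    filter_upwards [hX.2, hr, hψ't.eventually (hscale.and hgn)] with x hXx hrx hsx
    have h1 := hsx.1 _ hsx.2
    rw [hrx] at h1
    have hdet := (Matrix.isUnit_iff_isUnit_det _).1 hXx
    have hST : (S x)ᵀ = S x := Matrix.diagonal_transpose _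
    simp only [congruence, Function.comp_apply] at h1 ⊢
    set Z := X (ψ (dilate w (g (ψ' x)) (ψ' x)))
    set AZ := A (ψ (dilate w (g (ψ' x)) (ψ' x)))
    change (X x)ᵀ * A x * X x = S x * (Zᵀ * AZ * Z) * S x at h1
    have hT : ((X x)⁻¹)ᵀ * (X x)ᵀ = 1 := by
      rw [← Matrix.transpose_mul, Matrix.mul_nonsing_inv _ hdet, Matrix.transpose_one]
    calc A x = ((X x)⁻¹)ᵀ * (X x)ᵀ * A x * (X x * (X x)⁻¹) := by
          rw [hT, Matrix.mul_nonsing_inv _ hdet, one_mul, mul_one]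
      _ = ((X x)⁻¹)ᵀ * ((X x)ᵀ * A x * X x) * (X x)⁻¹ := by simp only [mul_assoc]
      _ = ((X x)⁻¹)ᵀ * (S x * (Zᵀ * AZ * Z) * S x) * (X x)⁻¹ := by rw [h1]
      _ = (Z * S x * (X x)⁻¹)ᵀ * AZ * (Z * S x * (X x)⁻¹) := by
          simp only [Matrix.transpose_mul, hST, mul_assoc]

/-- Volume form germs whose values at `0` differ by an exponential factor are isotopic through the
isotropy group of a symmetrically quasi-homogeneous germ. -/
theorem isotopic_of_exp (hm : m = ∞ ∨ m = ω) {A : (Fin r → 𝕜) → Matrix (Fin n) (Fin n) 𝕜}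
    (hA : IsMatrixGerm m A) (hq : IsSymmetricallyQuasiHomogeneous m A)
    {Ω₀ Ω₁ : (Fin r → 𝕜) → (Fin r → 𝕜) [⋀^Fin r]→L[𝕜] 𝕜} (h₀ : IsVolumeFormGerm m Ω₀)
    (h₁ : IsVolumeFormGerm m Ω₁) {c : 𝕜}
    (hc : Ω₀ 0 (Pi.basisFun 𝕜 (Fin r)) =
      NormedSpace.exp c * Ω₁ 0 (Pi.basisFun 𝕜 (Fin r))) :
    Isotopic m (isotropyGroup m A) Ω₀ Ω₁ := by
  have hm0 : m ≠ 0 := by rcases hm with rfl | rfl <;> simp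
  have hm1 : m + 1 ≤ m := by rcases hm with rfl | rfl <;> rfl
  obtain ⟨ψ, X, w, δ, ⟨hψ0, hψ, ψ', hψ'0, hψ', hl, hr⟩, hX, hw, hh⟩ := hq
  have hψ't : Tendsto ψ' (𝓝 0) (𝓝 0) := by simpa [ContinuousAt, hψ'0] using hψ'.continuousAt
  -- The Jacobians of the coordinate change and its inverse cancel when the density equation is
  -- carried back to the original coordinates.
  have hdd : ∀ᶠ x in 𝓝 0, (fderiv 𝕜 ψ (ψ' x)).det * (fderiv 𝕜 ψ' x).det = 1 := by
    filter_upwards [hr.eventually_nhds, hψ'.eventually_differentiableAt hm0,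
      hψ't.eventually (hψ.eventually_differentiableAt hm0)] with x hx h1 h2
    have h3 : HasFDerivAt (fun x => ψ (ψ' x)) ((fderiv 𝕜 ψ (ψ' x)).comp (fderiv 𝕜 ψ' x)) x :=
      h2.hasFDerivAt.comp x h1.hasFDerivAt
    have h4 : HasFDerivAt (fun x => ψ (ψ' x)) (ContinuousLinearMap.id 𝕜 (Fin r → 𝕜)) x :=
      (hasFDerivAt_id x).congr_of_eventuallyEq hx
    have h5 := congrArg ContinuousLinearMap.det (h3.unique h4)
    rw [det_comp] at h5
    exact h5.trans LinearMap.det_id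
  let e := Pi.basisFun 𝕜 (Fin r)
  have hρ : ∀ {Ω : (Fin r → 𝕜) → (Fin r → 𝕜) [⋀^Fin r]→L[𝕜] 𝕜}, IsVolumeFormGerm m Ω →
      RegularNear 𝕜 m (fun y => Ω (ψ y) e * (fderiv 𝕜 ψ y).det) 0 := fun hΩ =>
    ((hΩ.1.alternating_apply e).comp_of_eq hψ hψ0).mul (hψ.det_fderiv hm1)
  have hne : Ω₁ (ψ 0) e * (fderiv 𝕜 ψ 0).det ≠ 0 := by
    refine mul_ne_zero ?_ fun h => ?_
    · rw [hψ0]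
      intro h
      exact h₁.2 (ext_basisFun h)
    · have := hdd.self_of_nhds
      rw [hψ'0, h, zero_mul] at this
      exact zero_ne_one this
  obtain ⟨g, hg, hgeq⟩ := exists_dilation_pullback hm w hw (hρ h₀) (hρ h₁) hne (c := c) (by
    rw [hψ0, hc, mul_assoc])
  -- Membership in the isotropy group holds for every exponent germ, in particular for `t * g`.
  refine ⟨fun t x => ψ (dilate w (t * g (ψ' x)) (ψ' x)), fun t _ => ⟨?_, ?_⟩, ?_, ?_⟩
  · have hs : RegularNear 𝕜 m (fun p : 𝕜 × (Fin r → 𝕜) => ψ' p.2) ((t : 𝕜), 0) :=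
      hψ'.comp_of_eq (regularNear_of_contDiff contDiff_snd _) rfl
    have hgs : RegularNear 𝕜 m (fun p : 𝕜 × (Fin r → 𝕜) => g (ψ' p.2)) ((t : 𝕜), 0) :=
      hg.comp_of_eq hs hψ'0
    have hfst : RegularNear 𝕜 m (fun p : 𝕜 × (Fin r → 𝕜) => p.1) ((t : 𝕜), 0) :=
      regularNear_of_contDiff contDiff_fst _
    refine hψ.comp_of_eq (RegularNear.dilate w (hfst.mul hgs) hs) ?_
    rw [hψ'0, dilate_zero_right]
  · exact conj_dilate_mem_isotropyGroup hm0 hA hX hψ0 hψ hψ'0 hψ' hl hr w δ hh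
      (hg.const_mul (t : 𝕜))
  · filter_upwards [hr] with x hx
    rw [zero_mul, dilate_zero_left, hx]
  · simp only [one_mul]
    obtain ⟨hφ0, hφ, -⟩ := isDiffeoGerm_dilate hm0 w hg
    have hφt : Tendsto (fun x => dilate w (g x) x) (𝓝 0) (𝓝 0) := by
      simpa only [ContinuousAt, hφ0] using hφ.continuousAt
    filter_upwards [hdd, hr, hψ't.eventually hgeq, hψ'.eventually_differentiableAt hm0,
      hψ't.eventually (hφ.eventually_differentiableAt hm0),
      (hφt.comp hψ't).eventually (hψ.eventually_differentiableAt hm0)] with x h1 h2 h3 h4 h5 h6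
    have hd : HasFDerivAt (fun x => ψ (dilate w (g (ψ' x)) (ψ' x)))
        ((fderiv 𝕜 ψ (dilate w (g (ψ' x)) (ψ' x))).comp
          ((fderiv 𝕜 (fun y => dilate w (g y) y) (ψ' x)).comp (fderiv 𝕜 ψ' x))) x :=
      HasFDerivAt.comp (f := fun x => dilate w (g (ψ' x)) (ψ' x)) x h6.hasFDerivAt
        (HasFDerivAt.comp (g := fun y => dilate w (g y) y) x h5.hasFDerivAt h4.hasFDerivAt)
    apply ext_basisFun
    rw [pullback, compContinuousLinearMap_basisFun, hd.fderiv, det_comp, det_comp,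
      ← mul_assoc, ← mul_assoc, h3, h2, mul_assoc, h1, mul_one]

end Main

end SymGerm

theorem theorem2p1 (r n : ℕ) (m : WithTop ℕ∞) (hm : m = ∞ ∨ m = ω) :
    (∀ A : (Fin r → ℝ) → Matrix (Fin n) (Fin n) ℝ,
      SymGerm.IsSymGerm m A → SymGerm.IsSymmetricallyQuasiHomogeneous m A →
      ∀ Ω₀ Ω₁ : (Fin r → ℝ) → (Fin r → ℝ) [⋀^Fin r]→L[ℝ] ℝ,
        SymGerm.IsVolumeFormGerm m Ω₀ → SymGerm.IsVolumeFormGerm m Ω₁ →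
        SymGerm.SameOrientation Ω₀ Ω₁ →
        SymGerm.Isotopic m (SymGerm.isotropyGroup m A) Ω₀ Ω₁) ∧
    (∀ A : (Fin r → ℂ) → Matrix (Fin n) (Fin n) ℂ,
      SymGerm.IsSymGerm m A → SymGerm.IsSymmetricallyQuasiHomogeneous m A →
      ∀ Ω₀ Ω₁ : (Fin r → ℂ) → (Fin r → ℂ) [⋀^Fin r]→L[ℂ] ℂ,
        SymGerm.IsVolumeFormGerm m Ω₀ → SymGerm.IsVolumeFormGerm m Ω₁ →
        SymGerm.Isotopic m (SymGerm.isotropyGroup m A) Ω₀ Ω₁) := by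
  constructor
  · intro A hA hq Ω₀ Ω₁ h₀ h₁ ho
    obtain ⟨c, hc, hΩ⟩ := ho.exists_pos_right h₀.2 h₁.2
    -- Equal orientation makes the ratio at `0` positive, hence a real exponential; over `ℂ` every
    -- nonzero ratio is one.
    refine SymGerm.isotopic_of_exp hm hA.1 hq h₀ h₁ (c := Real.log c) ?_
    rw [hΩ, ← Real.exp_eq_exp_ℝ, Real.exp_log hc]
    rfl
  · intro A hA hq Ω₀ Ω₁ h₀ h₁
    have hne : ∀ {Ω : (Fin r → ℂ) → (Fin r → ℂ) [⋀^Fin r]→L[ℂ] ℂ}, Ω 0 ≠ 0 →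
        Ω 0 (Pi.basisFun ℂ (Fin r)) ≠ 0 := fun h h' => h (SymGerm.ext_basisFun h')
    refine SymGerm.isotopic_of_exp hm hA.1 hq h₀ h₁
      (c := Complex.log (Ω₀ 0 (Pi.basisFun ℂ (Fin r)) / Ω₁ 0 (Pi.basisFun ℂ (Fin r)))) ?_
    rw [← Complex.exp_eq_exp_ℂ, Complex.exp_log (div_ne_zero (hne h₀.2) (hne h₁.2)),
      div_mul_cancel₀ _ (hne h₁.2)]
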